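/- For a function $f:[0,2]\to\mathbb{C}$ and an integer $L\ge 1$, let $Q_Lf$ be the polynomial of degree at most $L$ with $(Q_Lf)(1+\cos\frac{\ell\pi}{L})=f(1+\cos\frac{\ell\pi}{L})$ for $\ell=0,\dots,L$, and let $e_L:=f-Q_Lf$. For an integer $m\ge 0$ put $\varrho_m(s):=(s(2-s))^{m-1/2}$ and $\|g\|_{\varrho_m}:=\big(\int_0^2|g(s)|^2\varrho_m(s)\,\mathrm{d}s\big)^{1/2}\in[0,\infty]$. For $m\ge1$, let $W_m$ be the set of all continuous $f:[0,2]\to\mathbb{C}$ that are $m-1$ times continuously differentiable in $(0,2)$ with $f,\dots,f^{(m-1)}$ absolutely continuous on every compact subinterval of $(0,2)$, so that $f^{(m)}$ exists almost everywhere. (a) For every integer $m\ge 1$ there exists a constant $C_m>0$ such that, for all integers $L\ge 1$ with $L\ge m-1$ and all $f\in W_m$, $$\|e_L\|_{\varrho_0}+L^{-1}\|e_L'\|_{\varrho_1}\le C_m L^{-m}\|f^{(m)}\|_{\varrho_m}.$$ (b) For every integer $m$ and real $m_0$ with $m\ge m_0>5/2$ there exists a constant $C_{m_0,m}>0$ such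 that, for all integers $L\ge m-1$ and all $f\in W_m$, $$\|e_L'\|_{L^\infty(0,2)}\le C_{m_0,m}L^{m_0-m}\|f^{(m)}\|_{\varrho_m},$$ and, for all integers $L\ge m$ and all $f\in W_{m+1}$, $$\|\varrho_1 e_L''\|_{L^\infty(0,2)}\le C_{m_0,m}L^{m_0-m}\|f^{(m+1)}\|_{\varrho_{m+1}}.$$ (The right-hand sides may be infinite, in which case the estimates are void.) -/

import Mathlib

open MeasureTheory Set
open scoped ENNReal NNReal

noncomputable section

namespace ClenshawCurtis

/-- The weight `ϱ_m(s) = (s (2 - s))^(m - 1/2)` on `(0, 2)`. -/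
def rho (m : ℕ) (s : ℝ) : ℝ := (s * (2 - s)) ^ ((m : ℝ) - 1 / 2)

/-- The weighted norm `‖g‖_{ϱ_m} = (∫_0^2 |g(s)|² ϱ_m(s) ds)^(1/2)`, with values in `[0, ∞]`. -/
def rhoNorm (m : ℕ) (g : ℝ → ℂ) : ℝ≥0∞ :=
  (∫⁻ s in Ioo (0 : ℝ) 2, ‖g s‖ₑ ^ 2 * ENNReal.ofReal (rho m s)) ^ (1 / 2 : ℝ)

/-- The norm of `L^∞(0, 2)`, with values in `[0, ∞]`. -/
def supNorm (g : ℝ → ℂ) : ℝ≥0∞ := eLpNorm g ∞ (volume.restrict (Ioo (0 : ℝ) 2))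

/-- The shifted Chebyshev nodes `1 + cos (ℓ π / L)`. -/
def node (L l : ℕ) : ℝ := 1 + Real.cos (l * Real.pi / L)

/-- The polynomial `Q_L f` of degree at most `L` interpolating `f` at `node L l`, `l = 0, …, L`. -/
def interpolant (L : ℕ) (f : ℝ → ℂ) : Polynomial ℂ :=
  Lagrange.interpolate (Finset.range (L + 1)) (fun l => (node L l : ℂ)) (fun l => f (node L l))

/-- The interpolation error `e_L = f - Q_L f`. -/
def interpError (L : ℕ) (f : ℝ → ℂ) (s : ℝ) : ℂ := f s - (interpolant L f).eval (s : ℂ)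

/-- `f` is continuous on `[0, 2]` and belongs to `W^{m,1}_loc(0, 2)`: it is `m - 1` times
continuously differentiable in `(0, 2)`, and its derivatives of order `< m` are absolutely
continuous on every compact subinterval of `(0, 2)`. Then the derivative of order `m` exists
almost everywhere and is the weak one. No integrability at the endpoints is imposed. -/
structure LocSobolev (m : ℕ) (f : ℝ → ℂ) : Prop where
  continuousOn : ContinuousOn f (Icc 0 2)
  contDiffOn : ∀ k < m, ContDiffOn ℝ k f (Ioo 0 2)
  absCont : ∀ k < m, ∀ a b : ℝ, 0 < a → a ≤ b → b < 2 →
    AbsolutelyContinuousOnInterval (iteratedDeriv k f) a b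

end ClenshawCurtis

end

open Filter Topology

noncomputable section

namespace ClenshawCurtis

/-! ### Mean squares of trigonometric series -/

/-! The substitution s = 1 + cos θ turns f into an even periodic function with a cosine series Σ aₙ
cos nθ, and ‖g‖²_{ϱ_m} into ∫₀^π |g(1 + cos θ)|² sin^{2m} θ dθ.

Coefficients. The derivatives Tₙ^{(m)}(cos θ) are orthogonal for sin^{2m} θ dθ, with squared norm
(π/2) ∏_{j<m}(n² − j²) for n ≥ m ≥ 1. Integrating by parts m times gives the coefficients of f^{(m)}
in this system, and Bessel's inequality bounds Σ_{n>L} n^{2m}|aₙ|² by a multiple of ‖f^{(m)}‖²_{ϱ_m}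
(`sum_tail_chebCoeff_le`). Since f is regular only inside (0, 2), this is done on [1 − r, 1 + r],
and then r → 1.

Aliasing. At the nodes cos nθ agrees with cos(n'θ), where n' = `fold L n` ≤ L. Hence e_L = Σ_{n>L}
aₙ (cos nθ − cos n'θ) (`hasSum_interpError`).

(a) The direct part is orthogonal. The folded part is orthogonal within each block kL ≤ n < (k+1)L,
and the blocks are summed by Cauchy–Schwarz with Σ k⁻² ≤ 2. For e_L' the same argument applies to
symmetric difference quotients, uniformly in the step, and Fatou's lemma concludes.

(b) The bounds |Tₙ'| ≤ n² and ϱ₁|Tₙ''| ≤ n³ reduce the claims to Σ_{n>L} n^q |aₙ| with q = 2, 3.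
Cauchy–Schwarz against the coefficient bound gives the rate L^{5/2−m}. -/

theorem integral_cos_int_mul (j : ℤ) :
    ∫ θ in (0 : ℝ)..Real.pi, Real.cos (j * θ) = if j = 0 then Real.pi else 0 := by
  split_ifs with h
  · simp [h]
  · have hj : (j : ℝ) ≠ 0 := by exact_mod_cast h
    rw [intervalIntegral.integral_comp_mul_left (fun x => Real.cos x) hj]
    simp [Real.sin_int_mul_pi]

/-- A sequence of continuous functions, pairwise orthogonal in `L²(0, π)`, with squared norms at
most `π`. -/
structure IsOrthoSystem (φ : ℕ → ℝ → ℝ) : Prop where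
  continuous : ∀ n, Continuous (φ n)
  orthogonal : ∀ i j, i ≠ j → ∫ θ in (0 : ℝ)..Real.pi, φ i θ * φ j θ = 0
  norm_le : ∀ i, ∫ θ in (0 : ℝ)..Real.pi, φ i θ * φ i θ ≤ Real.pi

theorem integral_cos_mul_cos (i j : ℕ) :
    ∫ θ in (0 : ℝ)..Real.pi, Real.cos (i * θ) * Real.cos (j * θ) =
      ((if (i : ℤ) - j = 0 then Real.pi else 0) + (if (i : ℤ) + j = 0 then Real.pi else 0)) / 2 := by
  rw [← integral_cos_int_mul, ← integral_cos_int_mul, ← intervalIntegral.integral_add,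
    ← intervalIntegral.integral_div]
  · congr 1; ext θ
    push_cast
    rw [sub_mul, add_mul, Real.cos_sub, Real.cos_add]; ring
  all_goals exact Continuous.intervalIntegrable (by fun_prop) _ _

theorem integral_sin_mul_sin (i j : ℕ) :
    ∫ θ in (0 : ℝ)..Real.pi, Real.sin (i * θ) * Real.sin (j * θ) =
      ((if (i : ℤ) - j = 0 then Real.pi else 0) - (if (i : ℤ) + j = 0 then Real.pi else 0)) / 2 := by
  rw [← integral_cos_int_mul, ← integral_cos_int_mul, ← intervalIntegral.integral_sub,
    ← intervalIntegral.integral_div]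
  · congr 1; ext θ
    push_cast
    rw [sub_mul, add_mul, Real.cos_sub, Real.cos_add]; ring
  all_goals exact Continuous.intervalIntegrable (by fun_prop) _ _

theorem isOrthoSystem_cos : IsOrthoSystem (fun n θ => Real.cos (n * θ)) where
  continuous n := by fun_prop
  orthogonal i j h := by
    rw [integral_cos_mul_cos, if_neg (by omega), if_neg (by omega)]; simp
  norm_le i := by
    rw [integral_cos_mul_cos]
    split_ifs <;> linarith [Real.pi_pos]

theorem isOrthoSystem_sin : IsOrthoSystem (fun n θ => Real.sin (n * θ)) where
  continuous n := by fun_prop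
  orthogonal i j h := by
    rw [integral_sin_mul_sin, if_neg (by omega), if_neg (by omega)]; simp
  norm_le i := by
    rw [integral_sin_mul_sin]
    split_ifs <;> linarith [Real.pi_pos]

/-- The relabelling `τ` is there for aliased frequencies: injectivity on `S` is all that is needed
for the cross terms to vanish. -/
theorem IsOrthoSystem.integral_sum_sq_le {φ : ℕ → ℝ → ℝ} (hφ : IsOrthoSystem φ) (S : Finset ℕ)
    (τ : ℕ → ℕ) (hτ : Set.InjOn τ S) (α : ℕ → ℝ) :
    ∫ θ in (0 : ℝ)..Real.pi, (∑ n ∈ S, α n * φ (τ n) θ) ^ 2 ≤ Real.pi * ∑ n ∈ S, α n ^ 2 := by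
  have hc := hφ.continuous
  have h1 : ∀ θ, (∑ n ∈ S, α n * φ (τ n) θ) ^ 2 =
      ∑ i ∈ S, ∑ j ∈ S, α i * α j * (φ (τ i) θ * φ (τ j) θ) := by
    intro θ
    rw [sq, Finset.sum_mul_sum]
    exact Finset.sum_congr rfl fun i _ => Finset.sum_congr rfl fun j _ => by ring
  simp_rw [h1]
  rw [intervalIntegral.integral_finsetSum
    (fun i _ => Continuous.intervalIntegrable (by fun_prop) _ _), Finset.mul_sum]
  refine Finset.sum_le_sum fun i hi => ?_
  rw [intervalIntegral.integral_finsetSum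
    (fun i _ => Continuous.intervalIntegrable (by fun_prop) _ _), Finset.sum_eq_single_of_mem i hi]
  · rw [intervalIntegral.integral_const_mul]
    nlinarith [hφ.norm_le (τ i), sq_nonneg (α i)]
  · intro j hj hji
    rw [intervalIntegral.integral_const_mul,
      hφ.orthogonal _ _ (fun h => hji (hτ hj hi h.symm)), mul_zero]

theorem IsOrthoSystem.lintegral_sum_sq_le {φ : ℕ → ℝ → ℝ} (hφ : IsOrthoSystem φ) (S : Finset ℕ)
    (τ : ℕ → ℕ) (hτ : Set.InjOn τ S) (α : ℕ → ℂ) :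
    ∫⁻ θ in Ioo (0 : ℝ) Real.pi, ‖∑ n ∈ S, α n * (φ (τ n) θ : ℂ)‖ₑ ^ 2 ≤
      ENNReal.ofReal Real.pi * ∑ n ∈ S, ‖α n‖ₑ ^ 2 := by
  have hc := hφ.continuous
  have h1 : ∀ θ, ‖∑ n ∈ S, α n * (φ (τ n) θ : ℂ)‖ ^ 2 =
      (∑ n ∈ S, (α n).re * φ (τ n) θ) ^ 2 + (∑ n ∈ S, (α n).im * φ (τ n) θ) ^ 2 := by
    intro θ
    rw [Complex.sq_norm, Complex.normSq_apply, Complex.re_sum, Complex.im_sum]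
    simp only [Complex.mul_re, Complex.mul_im, Complex.ofReal_re, Complex.ofReal_im, mul_zero,
      sub_zero, zero_add]
    ring
  have h2 : ∀ z : ℂ, ‖z‖ₑ ^ 2 = ENNReal.ofReal (‖z‖ ^ 2) := fun z => by
    rw [ENNReal.ofReal_pow (norm_nonneg _), ofReal_norm]
  simp_rw [h2]
  rw [← ENNReal.ofReal_sum_of_nonneg (fun _ _ => sq_nonneg _), ← ENNReal.ofReal_mul
    Real.pi_pos.le, ← ofReal_integral_eq_lintegral_ofReal]
  · apply ENNReal.ofReal_le_ofReal
    rw [← integral_Ioc_eq_integral_Ioo, ← intervalIntegral.integral_of_le Real.pi_pos.le]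
    simp_rw [h1]
    rw [intervalIntegral.integral_add (Continuous.intervalIntegrable (by fun_prop) _ _)
      (Continuous.intervalIntegrable (by fun_prop) _ _)]
    refine (add_le_add (hφ.integral_sum_sq_le S τ hτ _) (hφ.integral_sum_sq_le S τ hτ _)).trans ?_
    rw [← mul_add, ← Finset.sum_add_distrib]
    refine le_of_eq ?_
    congr 1
    refine Finset.sum_congr rfl fun i _ => ?_
    rw [Complex.sq_norm, Complex.normSq_apply]; ring
  · have : Continuous fun θ => ‖∑ n ∈ S, α n * (φ (τ n) θ : ℂ)‖ ^ 2 := by fun_prop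
    exact (this.integrableOn_Icc (a := 0) (b := Real.pi)).mono_set Ioo_subset_Icc_self
  · exact ae_of_all _ fun _ => sq_nonneg _

/-- Fatou's lemma for mean squares. -/
theorem lintegral_enorm_sq_le_of_tendsto {s : Set ℝ} {g : ℕ → ℝ → ℂ} {G : ℝ → ℂ} {C : ℝ≥0∞}
    (hs : MeasurableSet s) (hg : ∀ n, Measurable (g n))
    (hlim : ∀ θ ∈ s, G θ ≠ 0 → Tendsto (fun n => g n θ) atTop (𝓝 (G θ)))
    (hC : ∀ n, ∫⁻ θ in s, ‖g n θ‖ₑ ^ 2 ≤ C) :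
    ∫⁻ θ in s, ‖G θ‖ₑ ^ 2 ≤ C := by
  calc ∫⁻ θ in s, ‖G θ‖ₑ ^ 2 ≤ ∫⁻ θ in s, liminf (fun n => ‖g n θ‖ₑ ^ 2) atTop := by
        refine setLIntegral_mono' hs fun θ hθ => ?_
        -- Zeros of `G` need no convergence. This later lets `G` contain a `deriv` that takes the
        -- default value 0 at points of non-differentiability.
        by_cases h0 : G θ = 0
        · simp [h0]
        exact le_of_eq (((ENNReal.continuous_pow 2).tendsto _).comp
          ((continuous_enorm.tendsto _).comp (hlim θ hθ h0))).liminf_eq.symm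
    _ ≤ liminf (fun n => ∫⁻ θ in s, ‖g n θ‖ₑ ^ 2) atTop :=
        lintegral_liminf_le fun n => ((hg n).enorm.pow_const 2)
    _ ≤ C := by
        refine (liminf_le_liminf (Eventually.of_forall hC)).trans ?_
        simp

theorem IsOrthoSystem.lintegral_hasSum_sq_le {φ : ℕ → ℝ → ℝ} (hφ : IsOrthoSystem φ)
    (α : ℕ → ℂ) {G : ℝ → ℂ}
    (hG : ∀ θ ∈ Ioo (0 : ℝ) Real.pi, HasSum (fun n => α n * (φ n θ : ℂ)) (G θ)) :
    ∫⁻ θ in Ioo (0 : ℝ) Real.pi, ‖G θ‖ₑ ^ 2 ≤ ENNReal.ofReal Real.pi * ∑' n, ‖α n‖ₑ ^ 2 := by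
  have hc := hφ.continuous
  refine lintegral_enorm_sq_le_of_tendsto (g := fun N θ => ∑ n ∈ Finset.range N, α n * (φ n θ : ℂ))
    measurableSet_Ioo (fun N => ?_) (fun θ hθ _ => (hG θ hθ).tendsto_sum_nat) (fun N => ?_)
  · exact Continuous.measurable (by fun_prop)
  · refine (hφ.lintegral_sum_sq_le _ id (Function.injective_id.injOn) α).trans ?_
    gcongr
    exact ENNReal.sum_le_tsum _

theorem sum_range_mul_eq {M : Type*} [AddCommMonoid M] (u : ℕ → M) (K L : ℕ) :
    ∑ n ∈ Finset.range (K * L), u n =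
      ∑ k ∈ Finset.range K, ∑ j ∈ Finset.range L, u (k * L + j) := by
  induction K with
  | zero => simp
  | succ K ih => rw [Nat.succ_mul, Finset.sum_range_add, ih, Finset.sum_range_succ]

theorem sum_inv_sq_le_two (K : ℕ) : ∑ k ∈ Finset.range K, ((k : ℝ) ^ 2)⁻¹ ≤ 2 := by
  have h := sum_Ioo_inv_sq_le (α := ℝ) 0 K
  simp only [Nat.cast_zero, zero_add, div_one] at h
  refine le_trans ?_ h
  refine le_of_eq (Finset.sum_subset_zero_on_sdiff ?_ ?_ ?_).symm
  · intro k hk; simp at hk ⊢; omega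
  · intro k hk
    simp only [Finset.mem_sdiff, Finset.mem_range, Finset.mem_Ioo, not_and, not_lt] at hk
    have : k = 0 := by omega
    simp [this]
  · intros; rfl

/-- The Cauchy–Schwarz inequality with weights `k`. -/
theorem norm_sum_sq_le_weighted (K : ℕ) (B : ℕ → ℂ) (h0 : B 0 = 0) :
    ‖∑ k ∈ Finset.range K, B k‖ ^ 2 ≤ 2 * ∑ k ∈ Finset.range K, (k : ℝ) ^ 2 * ‖B k‖ ^ 2 := by
  have h1 : ‖∑ k ∈ Finset.range K, B k‖ ≤
      ∑ k ∈ Finset.range K, (k : ℝ)⁻¹ * (k * ‖B k‖) := by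
    refine (norm_sum_le _ _).trans (Finset.sum_le_sum fun k _ => ?_)
    -- At k = 0 the weight is 0⁻¹ = 0, which is why `B 0 = 0` is required.
    rcases Nat.eq_zero_or_pos k with rfl | hk
    · simp [h0]
    · have : (k : ℝ) ≠ 0 := by positivity
      rw [inv_mul_cancel_left₀ this]
  calc _ ≤ (∑ k ∈ Finset.range K, (k : ℝ)⁻¹ * (k * ‖B k‖)) ^ 2 := by gcongr
    _ ≤ (∑ k ∈ Finset.range K, ((k : ℝ)⁻¹) ^ 2) * ∑ k ∈ Finset.range K, (k * ‖B k‖) ^ 2 :=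
      Finset.sum_mul_sq_le_sq_mul_sq _ _ _
    _ ≤ _ := by
      simp_rw [inv_pow, mul_pow]
      gcongr
      exact sum_inv_sq_le_two K

/-- Mean square of a series in which the indices are folded, injectively on each block of
length `L`. -/
theorem IsOrthoSystem.lintegral_hasSum_folded_sq_le {φ : ℕ → ℝ → ℝ} (hφ : IsOrthoSystem φ)
    {L : ℕ} (hL : 1 ≤ L) (τ : ℕ → ℕ)
    (hτ : ∀ k, Set.InjOn (fun j => τ (k * L + j)) (Finset.range L : Finset ℕ))
    (α : ℕ → ℂ) (hα : ∀ n < L, α n = 0) {G : ℝ → ℂ}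
    (hG : ∀ θ ∈ Ioo (0 : ℝ) Real.pi, HasSum (fun n => α n * (φ (τ n) θ : ℂ)) (G θ)) :
    ∫⁻ θ in Ioo (0 : ℝ) Real.pi, (L : ℝ≥0∞) ^ 2 * ‖G θ‖ₑ ^ 2 ≤
      ENNReal.ofReal (2 * Real.pi) * ∑' n : ℕ, (n : ℝ≥0∞) ^ 2 * ‖α n‖ₑ ^ 2 := by
  have hc := hφ.continuous
  have hLtop : (L : ℝ≥0∞) ^ 2 ≠ ∞ := by simp
  set B : ℕ → ℝ → ℂ := fun k θ => ∑ j ∈ Finset.range L, α (k * L + j) * (φ (τ (k * L + j)) θ : ℂ)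
    with hB
  have hBc : ∀ k, Continuous (B k) := fun k => by simp only [hB]; fun_prop
  have hB0 : ∀ θ, B 0 θ = 0 := fun θ => Finset.sum_eq_zero fun j hj => by
    rw [hα _ (by simpa using hj), zero_mul]
  have key : ∀ K, ∫⁻ θ in Ioo (0 : ℝ) Real.pi, ‖∑ k ∈ Finset.range K, (L : ℂ) * B k θ‖ₑ ^ 2 ≤
      ENNReal.ofReal (2 * Real.pi) * ∑' n : ℕ, (n : ℝ≥0∞) ^ 2 * ‖α n‖ₑ ^ 2 := by
    intro K
    -- Weighting L·B_k by k produces (kL)², and kL ≤ n for every n in block k. Block 0 vanishes by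
    -- `hα`.
    have h1 : ∀ θ, ‖∑ k ∈ Finset.range K, (L : ℂ) * B k θ‖ₑ ^ 2 ≤
        2 * ∑ k ∈ Finset.range K, ((k * L : ℕ) : ℝ≥0∞) ^ 2 * ‖B k θ‖ₑ ^ 2 := by
      intro θ
      have := norm_sum_sq_le_weighted K (fun k => (L : ℂ) * B k θ) (by simp [hB0])
      have h := ENNReal.ofReal_le_ofReal this
      rw [ENNReal.ofReal_pow (norm_nonneg _), ofReal_norm, ENNReal.ofReal_mul two_pos.le,
        ENNReal.ofReal_sum_of_nonneg (fun _ _ => by positivity)] at h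
      refine h.trans (le_of_eq ?_)
      congr 1
      · simp
      refine Finset.sum_congr rfl fun k _ => ?_
      rw [norm_mul, mul_pow, ← mul_assoc, ← mul_pow, ENNReal.ofReal_mul (by positivity),
        ENNReal.ofReal_pow (norm_nonneg _), ofReal_norm, ENNReal.ofReal_pow (by positivity)]
      congr 2
      rw [Complex.norm_natCast, ← Nat.cast_mul, ENNReal.ofReal_natCast]
    refine (lintegral_mono h1).trans ?_
    rw [lintegral_const_mul _ (by
      refine Finset.measurable_sum _ fun k _ => ?_
      exact ((hBc k).measurable.enorm.pow_const 2).const_mul _),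
      lintegral_finsetSum _ (fun k _ => ((hBc k).measurable.enorm.pow_const 2).const_mul _)]
    simp_rw [lintegral_const_mul _ ((hBc _).measurable.enorm.pow_const 2)]
    have h2 : ∀ k, ((k * L : ℕ) : ℝ≥0∞) ^ 2 * ∫⁻ θ in Ioo (0 : ℝ) Real.pi, ‖B k θ‖ₑ ^ 2 ≤
        ENNReal.ofReal Real.pi * ∑ j ∈ Finset.range L,
          ((k * L + j : ℕ) : ℝ≥0∞) ^ 2 * ‖α (k * L + j)‖ₑ ^ 2 := by
      intro k
      calc _ ≤ ((k * L : ℕ) : ℝ≥0∞) ^ 2 *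
            (ENNReal.ofReal Real.pi * ∑ j ∈ Finset.range L, ‖α (k * L + j)‖ₑ ^ 2) := by
            gcongr
            exact hφ.lintegral_sum_sq_le _ (fun j => τ (k * L + j)) (hτ k) (fun j => α (k * L + j))
        _ = ENNReal.ofReal Real.pi * ∑ j ∈ Finset.range L,
          ((k * L : ℕ) : ℝ≥0∞) ^ 2 * ‖α (k * L + j)‖ₑ ^ 2 := by
            rw [← Finset.mul_sum]; ring
        _ ≤ _ := by
            gcongr
            omega
    calc _ ≤ 2 * ∑ k ∈ Finset.range K, (ENNReal.ofReal Real.pi * ∑ j ∈ Finset.range L,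
          ((k * L + j : ℕ) : ℝ≥0∞) ^ 2 * ‖α (k * L + j)‖ₑ ^ 2) := by
            gcongr 2 * ?_; exact Finset.sum_le_sum fun k _ => h2 k
      _ = ENNReal.ofReal (2 * Real.pi) *
          ∑ n ∈ Finset.range (K * L), (n : ℝ≥0∞) ^ 2 * ‖α n‖ₑ ^ 2 := by
            rw [sum_range_mul_eq, ← Finset.mul_sum, ENNReal.ofReal_mul two_pos.le,
              ENNReal.ofReal_ofNat, mul_assoc]
      _ ≤ _ := by gcongr; exact ENNReal.sum_le_tsum _
  have h3 : ∀ θ, (L : ℝ≥0∞) ^ 2 * ‖G θ‖ₑ ^ 2 = ‖(L : ℂ) * G θ‖ₑ ^ 2 := by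
    intro θ
    rw [enorm_mul, mul_pow]
    congr 2
    rw [← ofReal_norm, Complex.norm_natCast, ENNReal.ofReal_natCast]
  simp_rw [h3]
  refine lintegral_enorm_sq_le_of_tendsto measurableSet_Ioo
    (g := fun K θ => ∑ k ∈ Finset.range K, (L : ℂ) * B k θ) (fun K => ?_) (fun θ hθ _ => ?_) key
  · exact Continuous.measurable (by fun_prop)
  · simp_rw [← Finset.mul_sum]
    refine Tendsto.const_mul _ ?_
    have h4 := (hG θ hθ).tendsto_sum_nat.comp
      (tendsto_id.atTop_mul_const' (show 0 < L by omega))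
    refine h4.congr fun K => ?_
    simp only [Function.comp, id, hB]
    exact sum_range_mul_eq _ K L

/-! ### Absolutely continuous functions -/

/-- Monotonicity of `g` keeps disjoint intervals disjoint, and the Lipschitz bound controls their
total length. -/
theorem _root_.AbsolutelyContinuousOnInterval.comp_antitoneOn {X : Type*} [PseudoMetricSpace X]
    {f : ℝ → X} {g : ℝ → ℝ} {a b c d : ℝ} {K : ℝ≥0}
    (hf : AbsolutelyContinuousOnInterval f c d) (hg : AntitoneOn g (uIcc a b))
    (hK : LipschitzOnWith K g (uIcc a b)) (hm : MapsTo g (uIcc a b) (uIcc c d)) :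
    AbsolutelyContinuousOnInterval (fun x => f (g x)) a b := by
  rw [absolutelyContinuousOnInterval_iff] at hf ⊢
  intro ε hε
  obtain ⟨δ, hδ, H⟩ := hf ε hε
  -- `K + 1` instead of `K` covers K = 0.
  refine ⟨δ / (K + 1), by positivity, fun E hE hlen => ?_⟩
  obtain ⟨hE1, hE2⟩ := hE
  refine H (E.1, fun i => (g (E.2 i).1, g (E.2 i).2)) ⟨fun i hi => ?_, ?_⟩ ?_
  · exact ⟨hm (hE1 i hi).1, hm (hE1 i hi).2⟩
  · intro i hi j hj hij
    have hd := hE2 hi hj hij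
    have mem : ∀ i ∈ Finset.range E.1,
        min (E.2 i).1 (E.2 i).2 ∈ uIcc a b ∧ max (E.2 i).1 (E.2 i).2 ∈ uIcc a b := by
      intro i hi
      rcases le_total (E.2 i).1 (E.2 i).2 with h | h <;> simp [h, hE1 i hi]
    have key : ∀ i ∈ Finset.range E.1,
        uIoc (g (E.2 i).1) (g (E.2 i).2) =
          Ioc (g (max (E.2 i).1 (E.2 i).2)) (g (min (E.2 i).1 (E.2 i).2)) := by
      intro i hi
      rcases le_total (E.2 i).1 (E.2 i).2 with h | h
      · have := hg (hE1 i hi).1 (hE1 i hi).2 h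
        rw [uIoc_of_ge this, max_eq_right h, min_eq_left h]
      · have := hg (hE1 i hi).2 (hE1 i hi).1 h
        rw [uIoc_of_le this, max_eq_left h, min_eq_right h]
    simp only [Function.onFun] at hd ⊢
    rw [key i hi, key j hj]
    rw [uIoc, uIoc, Ioc_disjoint_Ioc] at hd
    rw [Ioc_disjoint_Ioc]
    obtain ⟨mi, Mi⟩ := mem i hi
    obtain ⟨mj, Mj⟩ := mem j hj
    generalize min (E.2 i).1 (E.2 i).2 = a1 at *
    generalize max (E.2 i).1 (E.2 i).2 = b1 at *
    generalize min (E.2 j).1 (E.2 j).2 = a2 at *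
    generalize max (E.2 j).1 (E.2 j).2 = b2 at *
    rcases min_le_iff.mp hd with h | h <;> rcases le_max_iff.mp h with h | h
    · exact (min_le_left _ _).trans ((hg Mi mi h).trans (le_max_left _ _))
    · exact (min_le_right _ _).trans ((hg Mi mj h).trans (le_max_left _ _))
    · exact (min_le_left _ _).trans ((hg Mj mi h).trans (le_max_right _ _))
    · exact (min_le_right _ _).trans ((hg Mj mj h).trans (le_max_right _ _))
  · calc ∑ i ∈ Finset.range E.1, dist (g (E.2 i).1) (g (E.2 i).2)
        ≤ ∑ i ∈ Finset.range E.1, K * dist (E.2 i).1 (E.2 i).2 :=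
          Finset.sum_le_sum fun i hi => hK.dist_le_mul _ (hE1 i hi).1 _ (hE1 i hi).2
      _ ≤ (K + 1) * ∑ i ∈ Finset.range E.1, dist (E.2 i).1 (E.2 i).2 := by
          rw [← Finset.mul_sum]
          gcongr
          simp
      _ < δ := by rwa [lt_div_iff₀' (by positivity)] at hlen

theorem _root_.LipschitzWith.comp_absolutelyContinuousOnInterval {X Y : Type*}
    [PseudoMetricSpace X] [PseudoMetricSpace Y] {f : ℝ → X} {g : X → Y} {a b : ℝ} {K : ℝ≥0}
    (hg : LipschitzWith K g) (hf : AbsolutelyContinuousOnInterval f a b) :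
    AbsolutelyContinuousOnInterval (fun x => g (f x)) a b := by
  unfold AbsolutelyContinuousOnInterval at hf ⊢
  refine squeeze_zero (fun E => Finset.sum_nonneg fun _ _ => dist_nonneg) (fun E => ?_)
    (by simpa using hf.const_mul (K : ℝ))
  rw [Finset.mul_sum]
  exact Finset.sum_le_sum fun i _ => hg.dist_le_mul _ _

/-- Integration by parts of an absolutely continuous complex function against a real function
vanishing at the endpoints. -/
theorem _root_.AbsolutelyContinuousOnInterval.integral_deriv_mul_eq_neg {u : ℝ → ℂ} {v : ℝ → ℝ}
    {a b : ℝ} (hu : AbsolutelyContinuousOnInterval u a b)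
    (hv : AbsolutelyContinuousOnInterval v a b) (hva : v a = 0) (hvb : v b = 0) :
    ∫ x in a..b, deriv u x * (v x : ℂ) = -∫ x in a..b, u x * ((deriv v x : ℝ) : ℂ) := by
  have h1 : AbsolutelyContinuousOnInterval (fun x => (u x).re) a b :=
    (Complex.reCLM.lipschitz).comp_absolutelyContinuousOnInterval hu
  have h2 : AbsolutelyContinuousOnInterval (fun x => (u x).im) a b :=
    (Complex.imCLM.lipschitz).comp_absolutelyContinuousOnInterval hu
  have e1 := h1.integral_mul_deriv_eq_deriv_mul hv
  have e2 := h2.integral_mul_deriv_eq_deriv_mul hv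
  simp only [hva, hvb, mul_zero, sub_zero, zero_sub] at e1 e2
  have i1 : IntervalIntegrable (fun x => deriv (fun x => (u x).re) x * v x) volume a b :=
    h1.intervalIntegrable_deriv.mul_continuousOn hv.continuousOn
  have i2 : IntervalIntegrable (fun x => deriv (fun x => (u x).im) x * v x) volume a b :=
    h2.intervalIntegrable_deriv.mul_continuousOn hv.continuousOn
  have i3 : IntervalIntegrable (fun x => (u x).re * deriv v x) volume a b :=
    hv.intervalIntegrable_deriv.continuousOn_mul h1.continuousOn
  have i4 : IntervalIntegrable (fun x => (u x).im * deriv v x) volume a b :=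
    hv.intervalIntegrable_deriv.continuousOn_mul h2.continuousOn
  have hR : ∀ w : ℝ → ℝ, IntervalIntegrable w volume a b →
      IntervalIntegrable (fun x => (w x : ℂ)) volume a b := fun w hw => ⟨hw.1.ofReal, hw.2.ofReal⟩
  have L : ∫ x in a..b, deriv u x * (v x : ℂ) =
      ((∫ x in a..b, deriv (fun x => (u x).re) x * v x : ℝ) : ℂ) +
        ((∫ x in a..b, deriv (fun x => (u x).im) x * v x : ℝ) : ℂ) * Complex.I := by
    rw [← intervalIntegral.integral_ofReal, ← intervalIntegral.integral_ofReal,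
      ← intervalIntegral.integral_mul_const, ← intervalIntegral.integral_add (hR _ i1)
        ((hR _ i2).mul_const _)]
    refine intervalIntegral.integral_congr_ae ?_
    -- `deriv` commutes with real and imaginary parts where `u` is differentiable, hence almost
    -- everywhere.
    filter_upwards [hu.boundedVariationOn.ae_differentiableAt_of_mem_uIcc] with x hx hxm
    have hd := (hx (uIoc_subset_uIcc hxm)).hasDerivAt
    have d1 : deriv (fun x => (u x).re) x = (deriv u x).re :=
      (Complex.reCLM.hasFDerivAt.comp_hasDerivAt x hd).deriv
    have d2 : deriv (fun x => (u x).im) x = (deriv u x).im :=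
      (Complex.imCLM.hasFDerivAt.comp_hasDerivAt x hd).deriv
    rw [d1, d2]
    nth_rw 1 [← Complex.re_add_im (deriv u x)]
    push_cast; ring
  have R : ∫ x in a..b, u x * ((deriv v x : ℝ) : ℂ) =
      ((∫ x in a..b, (u x).re * deriv v x : ℝ) : ℂ) +
        ((∫ x in a..b, (u x).im * deriv v x : ℝ) : ℂ) * Complex.I := by
    rw [← intervalIntegral.integral_ofReal, ← intervalIntegral.integral_ofReal,
      ← intervalIntegral.integral_mul_const, ← intervalIntegral.integral_add (hR _ i3)
        ((hR _ i4).mul_const _)]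
    refine intervalIntegral.integral_congr fun x _ => ?_
    nth_rw 1 [← Complex.re_add_im (u x)]
    push_cast; ring
  rw [L, R, e1, e2]
  push_cast; ring

/-! ### Derivatives of Chebyshev polynomials on the circle -/

/-- The value `T_n^{(k)}(cos θ)`. -/
def chebD (n k : ℕ) (θ : ℝ) : ℝ :=
  (Polynomial.derivative^[k] (Polynomial.Chebyshev.T ℝ n)).eval (Real.cos θ)

theorem chebD_zero (n : ℕ) (θ : ℝ) : chebD n 0 θ = Real.cos (n * θ) := by
  simp [chebD]

theorem hasDerivAt_chebD (n k : ℕ) (θ : ℝ) :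
    HasDerivAt (chebD n k) (-Real.sin θ * chebD n (k + 1) θ) θ := by
  have := (Polynomial.hasDerivAt (Polynomial.derivative^[k] (Polynomial.Chebyshev.T ℝ n))
    (Real.cos θ)).comp θ (Real.hasDerivAt_cos θ)
  rw [← Function.iterate_succ_apply' (f := Polynomial.derivative)] at this
  rw [mul_comm]
  exact this

theorem continuous_chebD (n k : ℕ) : Continuous (chebD n k) :=
  (Polynomial.continuous _).comp Real.continuous_cos

theorem contDiff_chebD (n k : ℕ) : ContDiff ℝ 1 (chebD n k) := by
  refine contDiff_one_iff_deriv.2 ⟨fun θ => (hasDerivAt_chebD n k θ).differentiableAt, ?_⟩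
  rw [funext fun θ => (hasDerivAt_chebD n k θ).deriv]
  exact Real.continuous_sin.neg.mul (continuous_chebD n (k + 1))

/-- This is Chebyshev's differential equation differentiated k times, at x = cos θ. -/
theorem sin_sq_mul_chebD (n k : ℕ) (θ : ℝ) :
    Real.sin θ ^ 2 * chebD n (k + 2) θ =
      (2 * k + 1) * Real.cos θ * chebD n (k + 1) θ - ((n : ℝ) ^ 2 - k ^ 2) * chebD n k θ := by
  have := Polynomial.Chebyshev.one_sub_X_sq_mul_iterate_derivative_T_eval (R := ℝ) n k
    (Real.cos θ)
  rw [Real.sin_sq]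
  simpa [chebD] using this

/-- The self-adjoint form of the preceding equation; it raises the order by one at each integration
by parts. -/
theorem hasDerivAt_sin_pow_mul_chebD (n k : ℕ) (θ : ℝ) :
    HasDerivAt (fun θ => Real.sin θ ^ (2 * k + 1) * chebD n (k + 1) θ)
      (((n : ℝ) ^ 2 - k ^ 2) * (Real.sin θ ^ (2 * k) * chebD n k θ)) θ := by
  have h := ((Real.hasDerivAt_sin θ).pow (2 * k + 1)).mul (hasDerivAt_chebD n (k + 1) θ)
  refine h.congr_deriv ?_
  have := sin_sq_mul_chebD n k θ
  simp only [Nat.add_sub_cancel, Pi.pow_apply]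
  push_cast
  linear_combination (-Real.sin θ ^ (2 * k)) * this

theorem absolutelyContinuous_of_contDiff {E : Type*} [NormedAddCommGroup E] [NormedSpace ℝ E]
    {u : ℝ → E} (hu : ContDiff ℝ 1 u) (a b : ℝ) : AbsolutelyContinuousOnInterval u a b := by
  obtain ⟨K, hK⟩ := hu.contDiffOn.exists_lipschitzOnWith (by decide) (convex_Icc _ _) isCompact_Icc
  exact LipschitzOnWith.absolutelyContinuousOnInterval hK

/-- The Sturm–Liouville relation of `T_n^{(k)}`, tested against an absolutely continuous
function. -/
theorem integral_mul_chebD_succ {U U₁ : ℝ → ℂ} {r : ℝ} (n k : ℕ)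
    (hU : AbsolutelyContinuousOnInterval U 0 Real.pi)
    (hd : ∀ θ ∈ Ioo 0 Real.pi, deriv U θ = -(r * Real.sin θ : ℝ) * U₁ θ) :
    r * ∫ θ in (0 : ℝ)..Real.pi, U₁ θ * (Real.sin θ ^ (2 * (k + 1)) * chebD n (k + 1) θ : ℝ) =
      ((n : ℝ) ^ 2 - k ^ 2 : ℝ) *
        ∫ θ in (0 : ℝ)..Real.pi, U θ * (Real.sin θ ^ (2 * k) * chebD n k θ : ℝ) := by
  set V : ℝ → ℝ := fun θ => Real.sin θ ^ (2 * k + 1) * chebD n (k + 1) θ with hV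
  have hVac : AbsolutelyContinuousOnInterval V 0 Real.pi :=
    absolutelyContinuous_of_contDiff ((Real.contDiff_sin.pow _).mul (contDiff_chebD _ _)) _ _
  have h := hU.integral_deriv_mul_eq_neg hVac (by simp [hV]) (by simp [hV])
  have hr : ∫ θ in (0 : ℝ)..Real.pi, U θ * ((deriv V θ : ℝ) : ℂ) = ((n : ℝ) ^ 2 - k ^ 2 : ℝ) *
        ∫ θ in (0 : ℝ)..Real.pi, U θ * (Real.sin θ ^ (2 * k) * chebD n k θ : ℝ) := by
    rw [← intervalIntegral.integral_const_mul]
    refine intervalIntegral.integral_congr fun θ _ => ?_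
    rw [(hasDerivAt_sin_pow_mul_chebD n k θ).deriv]
    push_cast; ring
  have hl : ∫ θ in (0 : ℝ)..Real.pi, deriv U θ * (V θ : ℂ) =
      -(r * ∫ θ in (0 : ℝ)..Real.pi,
        U₁ θ * (Real.sin θ ^ (2 * (k + 1)) * chebD n (k + 1) θ : ℝ)) := by
    rw [← intervalIntegral.integral_const_mul, ← intervalIntegral.integral_neg,
      intervalIntegral.integral_of_le Real.pi_pos.le, intervalIntegral.integral_of_le Real.pi_pos.le,
      integral_Ioc_eq_integral_Ioo, integral_Ioc_eq_integral_Ioo]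
    refine setIntegral_congr_fun measurableSet_Ioo fun θ hθ => ?_
    rw [hd θ hθ, hV]
    push_cast; ring
  rw [hr, hl] at h
  exact neg_injective h

/-- The factor `∏_{j < m} (n² - j²)`. -/
def lam (m n : ℕ) : ℝ := ∏ j ∈ Finset.range m, ((n : ℝ) ^ 2 - (j : ℝ) ^ 2)

theorem lam_succ (m n : ℕ) : lam (m + 1) n = lam m n * ((n : ℝ) ^ 2 - (m : ℝ) ^ 2) :=
  Finset.prod_range_succ _ _

/-- By repeated integration by parts, orthogonality of the cosines passes to the m-th derivatives,
with `lam m n` as the change of squared norm. -/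
theorem integral_chebD_mul_chebD (m n n' : ℕ) :
    ∫ θ in (0 : ℝ)..Real.pi, chebD n' m θ * (Real.sin θ ^ (2 * m) * chebD n m θ) =
      lam m n * ∫ θ in (0 : ℝ)..Real.pi, Real.cos (n' * θ) * Real.cos (n * θ) := by
  induction m with
  | zero => simp [lam, chebD_zero]
  | succ m ih =>
    have h := integral_mul_chebD_succ (U := fun θ => (chebD n' m θ : ℂ))
      (U₁ := fun θ => (chebD n' (m + 1) θ : ℂ)) (r := 1) n m
      (absolutelyContinuous_of_contDiff
        (Complex.ofRealCLM.contDiff.comp (contDiff_chebD n' m)) _ _)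
      (fun θ _ => by
        rw [(hasDerivAt_chebD n' m θ).ofReal_comp.deriv]; push_cast; ring)
    simp only [← Complex.ofReal_mul, intervalIntegral.integral_ofReal, one_mul] at h
    rw [Complex.ofReal_inj] at h
    rw [h, ih, lam_succ]; ring

/-- No differentiability of `g` is assumed: on (0, π) the inner map has a differentiable inverse
through `arccos`, so if `g` fails to be differentiable so does the composite, and both derivatives
default to 0. -/
theorem deriv_comp_one_add_mul_cos {g : ℝ → ℂ} {r : ℝ} (hr : 0 < r) {θ : ℝ}
    (hθ : θ ∈ Ioo 0 Real.pi) :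
    deriv (fun t => g (1 + r * Real.cos t)) θ =
      -(r * Real.sin θ : ℝ) * deriv g (1 + r * Real.cos θ) := by
  have hc : HasDerivAt (fun t => 1 + r * Real.cos t) (r * -Real.sin θ) θ :=
    ((Real.hasDerivAt_cos θ).const_mul r).const_add 1
  by_cases hg : DifferentiableAt ℝ g (1 + r * Real.cos θ)
  · have := hg.hasDerivAt.scomp θ hc
    have h2 := this.deriv
    simp only [Function.comp_def] at h2
    rw [h2, Complex.real_smul]
    push_cast; ring
  · rw [deriv_zero_of_not_differentiableAt hg, mul_zero]
    refine deriv_zero_of_not_differentiableAt fun hU => hg ?_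
    have hs1 : -1 < Real.cos θ := by
      have := Real.cos_lt_cos_of_nonneg_of_le_pi hθ.1.le le_rfl hθ.2
      simpa using this
    have hs2 : Real.cos θ < 1 := by
      have := Real.cos_lt_cos_of_nonneg_of_le_pi le_rfl hθ.2.le hθ.1
      simpa using this
    have hinv : (1 + r * Real.cos θ - 1) / r = Real.cos θ := by field_simp; ring
    have ha : DifferentiableAt ℝ (fun s : ℝ => Real.arccos ((s - 1) / r)) (1 + r * Real.cos θ) := by
      have h1 : DifferentiableAt ℝ Real.arccos ((1 + r * Real.cos θ - 1) / r) := by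
        rw [hinv]; exact Real.differentiableAt_arccos.2 ⟨hs1.ne', hs2.ne⟩
      exact h1.comp (f := fun s : ℝ => (s - 1) / r) _ (by fun_prop)
    have hpt : Real.arccos ((1 + r * Real.cos θ - 1) / r) = θ := by
      rw [hinv, Real.arccos_cos hθ.1.le hθ.2.le]
    have hU' : DifferentiableAt ℝ (fun t => g (1 + r * Real.cos t))
        (Real.arccos ((1 + r * Real.cos θ - 1) / r)) := by rwa [hpt]
    refine (hU'.comp (f := fun s : ℝ => Real.arccos ((s - 1) / r)) _ ha).congr_of_eventuallyEq ?_
    have hcont : ContinuousAt (fun s : ℝ => (s - 1) / r) (1 + r * Real.cos θ) := by fun_prop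
    have hmem : ∀ᶠ s in 𝓝 (1 + r * Real.cos θ), (s - 1) / r ∈ Ioo (-1 : ℝ) 1 :=
      hcont.eventually_mem (by rw [hinv]; exact Ioo_mem_nhds hs1 hs2)
    filter_upwards [hmem] with s hs
    simp only [Function.comp]
    rw [Real.cos_arccos hs.1.le hs.2.le]
    congr 1; field_simp; ring

/-- The Chebyshev coefficients of `f` on `[1 - r, 1 + r]` in terms of its derivative of
order `m`. -/
theorem LocSobolev.integral_iteratedDeriv_mul {f : ℝ → ℂ} {m : ℕ} (hf : LocSobolev m f) {r : ℝ}
    (hr0 : 0 < r) (hr1 : r < 1) (n : ℕ) :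
    (r : ℂ) ^ m * ∫ θ in (0 : ℝ)..Real.pi, iteratedDeriv m f (1 + r * Real.cos θ) *
        (Real.sin θ ^ (2 * m) * chebD n m θ : ℝ) =
      (lam m n : ℂ) * ∫ θ in (0 : ℝ)..Real.pi, f (1 + r * Real.cos θ) * Real.cos (n * θ) := by
  suffices h : ∀ k ≤ m, (r : ℂ) ^ k * ∫ θ in (0 : ℝ)..Real.pi,
      iteratedDeriv k f (1 + r * Real.cos θ) * (Real.sin θ ^ (2 * k) * chebD n k θ : ℝ) =
      (lam k n : ℂ) * ∫ θ in (0 : ℝ)..Real.pi, f (1 + r * Real.cos θ) * Real.cos (n * θ) from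
    h m le_rfl
  intro k
  induction k with
  | zero => intro _; simp [lam, chebD_zero]
  | succ k ih =>
    intro hk
    -- Since r < 1, the argument stays in the compact interval [1 − r, 1 + r] inside (0, 2).
    have hac : AbsolutelyContinuousOnInterval
        (fun θ => iteratedDeriv k f (1 + r * Real.cos θ)) 0 Real.pi := by
      refine (hf.absCont k (by omega) (1 - r) (1 + r) (by linarith) (by linarith)
        (by linarith)).comp_antitoneOn (g := fun θ => 1 + r * Real.cos θ) (K := ⟨r, hr0.le⟩) ?_ ?_ ?_
      · rw [uIcc_of_le Real.pi_pos.le]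
        intro x hx y hy hxy
        have := Real.antitoneOn_cos hx hy hxy
        simp only
        gcongr
      · refine LipschitzWith.lipschitzOnWith (LipschitzWith.of_dist_le_mul fun x y => ?_)
        have h1 : LipschitzWith 1 Real.cos := Real.lipschitzWith_cos
        have h2 := h1.dist_le_mul x y
        simp only [NNReal.coe_one, one_mul, Real.dist_eq] at h2 ⊢
        rw [show 1 + r * Real.cos x - (1 + r * Real.cos y) = r * (Real.cos x - Real.cos y) by ring,
          abs_mul, abs_of_pos hr0]
        exact mul_le_mul_of_nonneg_left h2 hr0.le
      · intro θ _
        rw [uIcc_of_le (by linarith)]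
        constructor <;> nlinarith [Real.neg_one_le_cos θ, Real.cos_le_one θ]
    have h := integral_mul_chebD_succ (U₁ := fun θ => iteratedDeriv (k + 1) f (1 + r * Real.cos θ))
      (r := r) n k hac (fun θ hθ => by
        rw [deriv_comp_one_add_mul_cos hr0 hθ, iteratedDeriv_succ])
    rw [pow_succ, mul_assoc, h, lam_succ, Complex.ofReal_mul, mul_assoc, mul_left_comm, ih (by omega)]
    ring

/-! ### Change of variables -/

theorem cos_mem_Ioo {θ : ℝ} (hθ : θ ∈ Ioo 0 Real.pi) : Real.cos θ ∈ Ioo (-1 : ℝ) 1 := by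
  constructor
  · simpa using Real.cos_lt_cos_of_nonneg_of_le_pi hθ.1.le le_rfl hθ.2
  · simpa using Real.cos_lt_cos_of_nonneg_of_le_pi le_rfl hθ.2.le hθ.1

theorem lintegral_image_one_add_mul_cos {r : ℝ} (hr : 0 < r) (h : ℝ → ℝ≥0∞) :
    ∫⁻ s in (fun θ => 1 + r * Real.cos θ) '' Ioo 0 Real.pi, h s =
      ∫⁻ θ in Ioo 0 Real.pi, ENNReal.ofReal (r * Real.sin θ) * h (1 + r * Real.cos θ) := by
  rw [lintegral_image_eq_lintegral_deriv_mul_of_antitoneOn (f' := fun θ => r * -Real.sin θ)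
    measurableSet_Ioo]
  · simp
  · intro θ _
    exact (((Real.hasDerivAt_cos θ).const_mul r).const_add 1).hasDerivWithinAt
  · intro x hx y hy hxy
    have := Real.antitoneOn_cos (Ioo_subset_Icc_self hx) (Ioo_subset_Icc_self hy) hxy
    simp only
    gcongr

theorem image_one_add_cos : (fun θ => 1 + 1 * Real.cos θ) '' Ioo 0 Real.pi = Ioo (0 : ℝ) 2 := by
  ext s
  constructor
  · rintro ⟨θ, hθ, rfl⟩
    have := cos_mem_Ioo hθ
    constructor <;> simp only <;> linarith [this.1, this.2]
  · intro hs
    refine ⟨Real.arccos (s - 1), ⟨Real.arccos_pos.2 (by linarith [hs.2]), ?_⟩, ?_⟩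
    · refine lt_of_le_of_ne (Real.arccos_le_pi _) fun h => ?_
      have := Real.arccos_eq_pi.1 h
      linarith [hs.1]
    · simp only
      rw [Real.cos_arccos (by linarith [hs.1]) (by linarith [hs.2])]; ring

theorem mul_rpow_sq {t : ℝ} (ht : 0 < t) (m : ℕ) :
    t * (t ^ 2) ^ ((m : ℝ) - 1 / 2) = t ^ (2 * m) := by
  rw [← Real.rpow_natCast t 2, ← Real.rpow_mul ht.le]
  nth_rw 1 [← Real.rpow_one t]
  rw [← Real.rpow_add ht, ← Real.rpow_natCast t (2 * m)]
  congr 1; push_cast; ring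

/-- The −1/2 in the exponent of the weight absorbs the Jacobian sin θ. -/
theorem sin_mul_rho {θ : ℝ} (hθ : θ ∈ Ioo 0 Real.pi) (m : ℕ) :
    Real.sin θ * rho m (1 + Real.cos θ) = Real.sin θ ^ (2 * m) := by
  rw [← mul_rpow_sq (Real.sin_pos_of_mem_Ioo hθ), rho, Real.sin_sq]
  congr 2; ring

/-- With s = 1 + r cos θ, s(2 − s) = 1 − r² cos² θ ≥ r² sin² θ, and m ≥ 1 makes the exponent
nonnegative. This makes the estimates on [1 − r, 1 + r] uniform in r. -/
theorem le_sin_mul_rho {r θ : ℝ} (hr0 : 0 < r) (hr1 : r ≤ 1) (hθ : θ ∈ Ioo 0 Real.pi) {m : ℕ}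
    (hm : 1 ≤ m) :
    (r * Real.sin θ) ^ (2 * m) ≤ r * Real.sin θ * rho m (1 + r * Real.cos θ) := by
  have hs := Real.sin_pos_of_mem_Ioo hθ
  have hm' : (1 : ℝ) ≤ m := by exact_mod_cast hm
  rw [← mul_rpow_sq (by positivity), rho]
  have h1 : (r * Real.sin θ) ^ 2 ≤ (1 + r * Real.cos θ) * (2 - (1 + r * Real.cos θ)) := by
    rw [mul_pow, Real.sin_sq]; nlinarith
  gcongr
  linarith

/-- The square of the weighted norm. -/
def rhoInt (m : ℕ) (g : ℝ → ℂ) : ℝ≥0∞ :=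
  ∫⁻ s in Ioo (0 : ℝ) 2, ‖g s‖ₑ ^ 2 * ENNReal.ofReal (rho m s)

theorem rhoInt_eq (m : ℕ) (g : ℝ → ℂ) :
    rhoInt m g = ∫⁻ θ in Ioo 0 Real.pi,
      ‖g (1 + Real.cos θ)‖ₑ ^ 2 * ENNReal.ofReal (Real.sin θ ^ (2 * m)) := by
  rw [rhoInt, ← image_one_add_cos, lintegral_image_one_add_mul_cos one_pos]
  refine setLIntegral_congr_fun measurableSet_Ioo fun θ hθ => ?_
  simp only [one_mul]
  rw [← sin_mul_rho hθ, ENNReal.ofReal_mul (Real.sin_pos_of_mem_Ioo hθ).le]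
  ring

theorem lintegral_le_rhoInt {r : ℝ} (hr0 : 0 < r) (hr1 : r ≤ 1) {m : ℕ} (hm : 1 ≤ m)
    (g : ℝ → ℂ) :
    ∫⁻ θ in Ioo 0 Real.pi, ‖g (1 + r * Real.cos θ)‖ₑ ^ 2 *
      ENNReal.ofReal ((r * Real.sin θ) ^ (2 * m)) ≤ rhoInt m g := by
  calc _ ≤ ∫⁻ θ in Ioo 0 Real.pi, ENNReal.ofReal (r * Real.sin θ) *
        (‖g (1 + r * Real.cos θ)‖ₑ ^ 2 * ENNReal.ofReal (rho m (1 + r * Real.cos θ))) := by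
        refine setLIntegral_mono' measurableSet_Ioo fun θ hθ => ?_
        rw [mul_left_comm, ← ENNReal.ofReal_mul
          (mul_pos hr0 (Real.sin_pos_of_mem_Ioo hθ)).le]
        gcongr
        exact le_sin_mul_rho hr0 hr1 hθ hm
    _ = ∫⁻ s in (fun θ => 1 + r * Real.cos θ) '' Ioo 0 Real.pi,
          ‖g s‖ₑ ^ 2 * ENNReal.ofReal (rho m s) :=
        (lintegral_image_one_add_mul_cos hr0
          (fun s => ‖g s‖ₑ ^ 2 * ENNReal.ofReal (rho m s))).symm
    _ ≤ _ := by
        refine lintegral_mono_set ?_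
        rintro _ ⟨θ, hθ, rfl⟩
        have := cos_mem_Ioo hθ
        constructor <;> simp only <;> nlinarith [this.1, this.2]

/-! ### Bessel's inequality -/

/-- Expand the nonnegative integral of (G − Σ cₙψₙ)², where cₙ are the projection coefficients; the
`ψ n` are not normalised, whence `N n`. -/
theorem bessel_real {Ω : Type*} [MeasurableSpace Ω] {μ : Measure Ω} (S : Finset ℕ)
    {G : Ω → ℝ} {ψ : ℕ → Ω → ℝ} {N : ℕ → ℝ} (hG : Integrable (fun x => G x ^ 2) μ)
    (hGψ : ∀ n, Integrable (fun x => G x * ψ n x) μ)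
    (hψ : ∀ i j, Integrable (fun x => ψ i x * ψ j x) μ)
    (ho : ∀ i ∈ S, ∀ j ∈ S, i ≠ j → ∫ x, ψ i x * ψ j x ∂μ = 0)
    (hN : ∀ i ∈ S, ∫ x, ψ i x * ψ i x ∂μ = N i) (hpos : ∀ i ∈ S, 0 < N i) :
    ∑ n ∈ S, (∫ x, G x * ψ n x ∂μ) ^ 2 / N n ≤ ∫ x, G x ^ 2 ∂μ := by
  set c : ℕ → ℝ := fun n => (∫ x, G x * ψ n x ∂μ) / N n with hc
  have h0 : 0 ≤ ∫ x, (G x - ∑ n ∈ S, c n * ψ n x) ^ 2 ∂μ := integral_nonneg fun _ => sq_nonneg _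
  have h1 : ∀ x, (G x - ∑ n ∈ S, c n * ψ n x) ^ 2 = G x ^ 2 -
      ∑ n ∈ S, 2 * c n * (G x * ψ n x) + ∑ i ∈ S, ∑ j ∈ S, c i * c j * (ψ i x * ψ j x) := by
    intro x
    have e1 : ∑ n ∈ S, 2 * c n * (G x * ψ n x) = 2 * G x * ∑ n ∈ S, c n * ψ n x := by
      rw [Finset.mul_sum]; exact Finset.sum_congr rfl fun _ _ => by ring
    have e2 : ∑ i ∈ S, ∑ j ∈ S, c i * c j * (ψ i x * ψ j x) = (∑ n ∈ S, c n * ψ n x) ^ 2 := by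
      rw [sq, Finset.sum_mul_sum]
      exact Finset.sum_congr rfl fun i _ => Finset.sum_congr rfl fun j _ => by ring
    rw [e1, e2]; ring
  simp_rw [h1] at h0
  have i1 : Integrable (fun x => ∑ n ∈ S, 2 * c n * (G x * ψ n x)) μ :=
    integrable_finsetSum _ fun n _ => (hGψ n).const_mul _
  have i2 : ∀ i, Integrable (fun x => ∑ j ∈ S, c i * c j * (ψ i x * ψ j x)) μ := fun i =>
    integrable_finsetSum _ fun j _ => (hψ i j).const_mul _
  rw [integral_add (show Integrable (fun x => G x ^ 2 - ∑ n ∈ S, 2 * c n * (G x * ψ n x)) μ from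
      hG.sub i1) (integrable_finsetSum _ fun i _ => i2 i), integral_sub hG i1,
    integral_finsetSum _ (fun n _ => (hGψ n).const_mul _),
    integral_finsetSum _ (fun i _ => i2 i)] at h0
  have h2 : ∑ i ∈ S, ∫ x, ∑ j ∈ S, c i * c j * (ψ i x * ψ j x) ∂μ =
      ∑ n ∈ S, (∫ x, G x * ψ n x ∂μ) ^ 2 / N n := by
    refine Finset.sum_congr rfl fun i hi => ?_
    rw [integral_finsetSum _ (fun j _ => (hψ i j).const_mul _), Finset.sum_eq_single_of_mem i hi]
    · rw [integral_const_mul, hN i hi]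
      have := (hpos i hi).ne'
      simp only [hc]; field_simp
    · intro j hj hji
      rw [integral_const_mul, ho i hi j hj hji.symm, mul_zero]
  have h3 : ∑ n ∈ S, ∫ x, 2 * c n * (G x * ψ n x) ∂μ =
      2 * ∑ n ∈ S, (∫ x, G x * ψ n x ∂μ) ^ 2 / N n := by
    rw [Finset.mul_sum]
    refine Finset.sum_congr rfl fun i hi => ?_
    rw [integral_const_mul]
    simp only [hc]; ring
  rw [h2, h3] at h0
  linarith

theorem bessel_complex {Ω : Type*} [MeasurableSpace Ω] {μ : Measure Ω} [IsFiniteMeasure μ]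
    (S : Finset ℕ) {G : Ω → ℂ} {ψ : ℕ → Ω → ℝ} {N : ℕ → ℝ} (hG : MemLp G 2 μ)
    (hψ : ∀ n, MemLp (ψ n) 2 μ)
    (ho : ∀ i ∈ S, ∀ j ∈ S, i ≠ j → ∫ x, ψ i x * ψ j x ∂μ = 0)
    (hN : ∀ i ∈ S, ∫ x, ψ i x * ψ i x ∂μ = N i) (hpos : ∀ i ∈ S, 0 < N i) :
    ENNReal.ofReal (∑ n ∈ S, ‖∫ x, G x * (ψ n x : ℂ) ∂μ‖ ^ 2 / N n) ≤
      ∫⁻ x, ‖G x‖ₑ ^ 2 ∂μ := by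
  have hre : MemLp (fun x => (G x).re) 2 μ := hG.re
  have him : MemLp (fun x => (G x).im) 2 μ := hG.im
  have b1 := bessel_real S hre.integrable_sq (fun n => hre.integrable_mul (hψ n))
    (fun i j => (hψ i).integrable_mul (hψ j)) ho hN hpos
  have b2 := bessel_real S him.integrable_sq (fun n => him.integrable_mul (hψ n))
    (fun i j => (hψ i).integrable_mul (hψ j)) ho hN hpos
  have h2 : ∀ z : ℂ, ‖z‖ₑ ^ 2 = ENNReal.ofReal (‖z‖ ^ 2) := fun z => by
    rw [ENNReal.ofReal_pow (norm_nonneg _), ofReal_norm]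
  simp_rw [h2]
  rw [← ofReal_integral_eq_lintegral_ofReal hG.norm.integrable_sq
    (ae_of_all _ fun _ => sq_nonneg _)]
  apply ENNReal.ofReal_le_ofReal
  have h3 : ∀ x, ‖G x‖ ^ 2 = (G x).re ^ 2 + (G x).im ^ 2 := fun x => by
    rw [Complex.sq_norm, Complex.normSq_apply]; ring
  simp_rw [h3]
  rw [integral_add hre.integrable_sq him.integrable_sq]
  refine le_trans (le_of_eq ?_) (add_le_add b1 b2)
  rw [← Finset.sum_add_distrib]
  refine Finset.sum_congr rfl fun n _ => ?_
  have hint : Integrable (fun x => G x * (ψ n x : ℂ)) μ :=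
    hG.integrable_mul (hψ n).ofReal
  have e1 : (∫ x, G x * (ψ n x : ℂ) ∂μ).re = ∫ x, (G x).re * ψ n x ∂μ := by
    have := integral_re hint
    simp only [RCLike.re_to_complex] at this
    rw [← this]; congr 1; ext x; simp
  have e2 : (∫ x, G x * (ψ n x : ℂ) ∂μ).im = ∫ x, (G x).im * ψ n x ∂μ := by
    have := integral_im hint
    simp only [RCLike.im_to_complex] at this
    rw [← this]; congr 1; ext x; simp
  rw [Complex.sq_norm, Complex.normSq_apply, e1, e2]
  ring

/-- Every factor is at least n²/m: from j ≤ m − 1 and m ≤ n follow jm ≤ (m − 1)n and j ≤ n, hence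
j²m ≤ (m − 1)n². -/
theorem lam_ge {m n : ℕ} (hm : 1 ≤ m) (hn : m ≤ n) : (n : ℝ) ^ (2 * m) / (m : ℝ) ^ m ≤ lam m n := by
  have hm0 : (0 : ℝ) < m := by exact_mod_cast hm
  have h : ∀ j ∈ Finset.range m, (n : ℝ) ^ 2 / m ≤ (n : ℝ) ^ 2 - (j : ℝ) ^ 2 := by
    intro j hj
    have hj : (j : ℝ) + 1 ≤ m := by exact_mod_cast Finset.mem_range.1 hj
    have hn' : (m : ℝ) ≤ n := by exact_mod_cast hn
    have hj0 : (0 : ℝ) ≤ j := by positivity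
    have h1 : (j : ℝ) * m ≤ (m - 1) * n := by nlinarith
    have hm1 : (1 : ℝ) ≤ m := by exact_mod_cast hm
    have h2 : (j : ℝ) ^ 2 * m ≤ (m - 1) * n ^ 2 := by
      have : (j : ℝ) * n * m ≤ (m - 1) * n * n := by nlinarith
      nlinarith
    rw [div_le_iff₀ hm0]
    linarith
  calc (n : ℝ) ^ (2 * m) / (m : ℝ) ^ m = ∏ j ∈ Finset.range m, ((n : ℝ) ^ 2 / m) := by
        rw [Finset.prod_const, Finset.card_range, div_pow, pow_mul]
    _ ≤ _ := Finset.prod_le_prod (fun _ _ => by positivity) h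

theorem lam_pos {m n : ℕ} (hm : 1 ≤ m) (hn : m ≤ n) : 0 < lam m n :=
  lt_of_lt_of_le (by have : 0 < n := by omega
                     positivity) (lam_ge hm hn)

/-- Bessel's inequality for f^{(m)}(1 + r cos θ)(r sin θ)^m against sinᵐ θ · Tₙ^{(m)}(cos θ). The
coefficient is `lam m n` times the cosine integral and the squared norm is `lam m n` · π/2, so one
factor `lam m n` remains. -/
theorem sum_lam_mul_sq_le_of_lt_one {f : ℝ → ℂ} {m : ℕ} (hm : 1 ≤ m) (hf : LocSobolev m f)
    (hfin : rhoInt m (iteratedDeriv m f) ≠ ∞) {r : ℝ} (hr0 : 0 < r) (hr1 : r < 1)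
    (S : Finset ℕ) (hS : ∀ n ∈ S, m ≤ n) :
    ENNReal.ofReal (2 / Real.pi * ∑ n ∈ S, lam m n *
      ‖∫ θ in (0 : ℝ)..Real.pi, f (1 + r * Real.cos θ) * Real.cos (n * θ)‖ ^ 2) ≤
      rhoInt m (iteratedDeriv m f) := by
  set μ : Measure ℝ := volume.restrict (Ioo 0 Real.pi) with hμ
  have hmeas : Measurable (iteratedDeriv m f) := by
    obtain ⟨k, rfl⟩ : ∃ k, m = k + 1 := ⟨m - 1, by omega⟩
    rw [iteratedDeriv_succ]
    exact measurable_deriv _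
  set G : ℝ → ℂ := fun θ =>
    iteratedDeriv m f (1 + r * Real.cos θ) * ((r * Real.sin θ) ^ m : ℝ) with hGdef
  have hGm : Measurable G := by
    refine (hmeas.comp ?_).mul ?_
    · exact Continuous.measurable (by fun_prop)
    · exact Continuous.measurable (by fun_prop)
  have hGle : ∫⁻ θ, ‖G θ‖ₑ ^ 2 ∂μ ≤ rhoInt m (iteratedDeriv m f) := by
    refine le_trans (le_of_eq ?_) (lintegral_le_rhoInt hr0 hr1.le hm _)
    refine lintegral_congr fun θ => ?_
    have : ‖(((r * Real.sin θ) ^ m : ℝ) : ℂ)‖ₑ ^ 2 =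
        ENNReal.ofReal ((r * Real.sin θ) ^ (2 * m)) := by
      rw [← ofReal_norm, ← ENNReal.ofReal_pow (norm_nonneg _), Complex.norm_real, Real.norm_eq_abs,
        sq_abs, ← pow_mul, mul_comm m]
    rw [hGdef, enorm_mul, mul_pow, this]
  have hG2 : MemLp G 2 μ := by
    refine ⟨hGm.aestronglyMeasurable, ?_⟩
    rw [eLpNorm_lt_top_iff_lintegral_rpow_enorm_lt_top (by simp) (by simp)]
    simpa using hGle.trans_lt hfin.lt_top
  set ψ : ℕ → ℝ → ℝ := fun n θ => Real.sin θ ^ m * chebD n m θ with hψdef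
  have hψc : ∀ n, Continuous (ψ n) := fun n =>
    (Real.continuous_sin.pow m).mul (continuous_chebD n m)
  have hψ2 : ∀ n, MemLp (ψ n) 2 μ := fun n => by
    obtain ⟨C, hC⟩ := isCompact_Icc.exists_bound_of_continuousOn
      (hψc n).continuousOn (s := Icc 0 Real.pi)
    refine MemLp.of_bound (hψc n).aestronglyMeasurable C ?_
    filter_upwards [ae_restrict_mem measurableSet_Ioo] with θ hθ
    exact hC θ (Ioo_subset_Icc_self hθ)
  have hint : ∀ {E : Type} [NormedAddCommGroup E] [NormedSpace ℝ E] (w : ℝ → E),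
      ∫ θ, w θ ∂μ = ∫ θ in (0 : ℝ)..Real.pi, w θ := fun w => by
    rw [intervalIntegral.integral_of_le Real.pi_pos.le, integral_Ioc_eq_integral_Ioo]
  have hψψ : ∀ i j, ∫ θ, ψ i θ * ψ j θ ∂μ =
      lam m j * ∫ θ in (0 : ℝ)..Real.pi, Real.cos (i * θ) * Real.cos (j * θ) := by
    intro i j
    rw [hint, ← integral_chebD_mul_chebD]
    congr 1; ext θ
    simp only [hψdef]; ring
  have hB := bessel_complex S hG2 hψ2 (N := fun n => lam m n * (Real.pi / 2))
    (fun i hi j hj hij => by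
      rw [hψψ, isOrthoSystem_cos.orthogonal i j hij, mul_zero])
    (fun i hi => by
      have := hS i hi
      rw [hψψ, integral_cos_mul_cos, if_pos (by omega), if_neg (by omega), add_zero])
    (fun i hi => mul_pos (lam_pos hm (hS i hi)) (by positivity))
  refine le_trans (le_of_eq ?_) (hB.trans hGle)
  congr 1
  rw [Finset.mul_sum]
  refine Finset.sum_congr rfl fun n hn => ?_
  have h1 := hf.integral_iteratedDeriv_mul hr0 hr1 n
  have h2 : ∫ θ, G θ * (ψ n θ : ℂ) ∂μ =
      (lam m n : ℂ) * ∫ θ in (0 : ℝ)..Real.pi, f (1 + r * Real.cos θ) * Real.cos (n * θ) := by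
    rw [← h1, hint, ← intervalIntegral.integral_const_mul]
    congr 1; ext θ
    simp only [hGdef, hψdef]
    push_cast; ring
  rw [h2, norm_mul, Complex.norm_real, Real.norm_eq_abs, abs_of_pos (lam_pos hm (hS n hn))]
  have := (lam_pos hm (hS n hn)).ne'
  have := Real.pi_pos.ne'
  field_simp

/-- The cosine integrals `∫_0^π f(1 + cos θ) cos(nθ) dθ`. -/
def cosInt (f : ℝ → ℂ) (n : ℕ) : ℂ :=
  ∫ θ in (0 : ℝ)..Real.pi, f (1 + Real.cos θ) * Real.cos (n * θ)

/-- Continuity of `f` up to the endpoints is used here; extending `f` by constants makes the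
integrand jointly continuous in r and θ. -/
theorem tendsto_cosInt {f : ℝ → ℂ} (hf : ContinuousOn f (Icc 0 2)) (n : ℕ) :
    Tendsto (fun r : ℝ => ∫ θ in (0 : ℝ)..Real.pi, f (1 + r * Real.cos θ) * Real.cos (n * θ))
      (𝓝[<] 1) (𝓝 (cosInt f n)) := by
  set g : ℝ → ℂ := IccExtend (zero_le_two (α := ℝ)) ((Icc 0 2).domRestrict f) with hg
  have hgc : Continuous g := (continuousOn_iff_continuous_domRestrict.1 hf).Icc_extend'
  have hgf : ∀ s ∈ Icc (0 : ℝ) 2, g s = f s := fun s hs => by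
    rw [hg, IccExtend_of_mem _ _ hs]; rfl
  have hmem : ∀ r ∈ Ioc (0 : ℝ) 1, ∀ θ : ℝ, 1 + r * Real.cos θ ∈ Icc (0 : ℝ) 2 := by
    intro r hr θ
    constructor <;> nlinarith [Real.neg_one_le_cos θ, Real.cos_le_one θ, hr.1, hr.2]
  have hcont : Continuous fun r : ℝ =>
      ∫ θ in (0 : ℝ)..Real.pi, g (1 + r * Real.cos θ) * Real.cos (n * θ) :=
    intervalIntegral.continuous_parametric_intervalIntegral_of_continuous' (by
      simp only [Function.uncurry_def]; fun_prop) _ _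
  have h1 := (hcont.tendsto 1).mono_left (nhdsWithin_le_nhds (s := Iio 1))
  have e : ∀ r ∈ Ioc (0 : ℝ) 1, ∫ θ in (0 : ℝ)..Real.pi, g (1 + r * Real.cos θ) * Real.cos (n * θ) =
      ∫ θ in (0 : ℝ)..Real.pi, f (1 + r * Real.cos θ) * Real.cos (n * θ) := fun r hr => by
    congr 1; ext θ; rw [hgf _ (hmem r hr θ)]
  rw [e 1 ⟨one_pos, le_rfl⟩] at h1
  simp only [one_mul] at h1
  refine h1.congr' ?_
  filter_upwards [Ioo_mem_nhdsLT (zero_lt_one (α := ℝ))] with r hr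
  exact e r ⟨hr.1, hr.2.le⟩

theorem sum_lam_mul_sq_le {f : ℝ → ℂ} {m : ℕ} (hm : 1 ≤ m) (hf : LocSobolev m f)
    (hfin : rhoInt m (iteratedDeriv m f) ≠ ∞) (S : Finset ℕ) (hS : ∀ n ∈ S, m ≤ n) :
    ENNReal.ofReal (2 / Real.pi * ∑ n ∈ S, lam m n * ‖cosInt f n‖ ^ 2) ≤
      rhoInt m (iteratedDeriv m f) := by
  have ht : Tendsto (fun r : ℝ => ENNReal.ofReal (2 / Real.pi * ∑ n ∈ S, lam m n *
      ‖∫ θ in (0 : ℝ)..Real.pi, f (1 + r * Real.cos θ) * Real.cos (n * θ)‖ ^ 2)) (𝓝[<] 1)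
      (𝓝 (ENNReal.ofReal (2 / Real.pi * ∑ n ∈ S, lam m n * ‖cosInt f n‖ ^ 2))) := by
    refine ENNReal.tendsto_ofReal (Tendsto.const_mul _ (tendsto_finsetSum _ fun n _ => ?_))
    exact Tendsto.const_mul _ ((tendsto_cosInt hf.continuousOn n).norm.pow 2)
  refine le_of_tendsto ht ?_
  filter_upwards [Ioo_mem_nhdsLT (zero_lt_one (α := ℝ))] with r hr
  exact sum_lam_mul_sq_le_of_lt_one hm hf hfin hr.1 hr.2 S hS

/-! ### Chebyshev expansion -/

/-- The `n`-th Chebyshev coefficient of `f` on `[0, 2]`. -/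
def chebCoeff (f : ℝ → ℂ) (n : ℕ) : ℂ :=
  if n = 0 then (Real.pi : ℂ)⁻¹ * cosInt f 0 else 2 * (Real.pi : ℂ)⁻¹ * cosInt f n

/-- A sequence with the terms of index at most `L` removed. -/
def tail (L : ℕ) (a : ℕ → ℂ) (n : ℕ) : ℂ := if L < n then a n else 0

theorem tail_of_le {L n : ℕ} (a : ℕ → ℂ) (h : n ≤ L) : tail L a n = 0 := if_neg (by omega)

/-- The central coefficient estimate. The condition m ≤ L + 1 ensures that the surviving indices n >
L satisfy n ≥ m, where `lam_ge` applies and costs the factor mᵐ. -/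
theorem sum_tail_chebCoeff_le {f : ℝ → ℂ} {m L : ℕ} (hm : 1 ≤ m) (hmL : m ≤ L + 1)
    (hf : LocSobolev m f) (hfin : rhoInt m (iteratedDeriv m f) ≠ ∞) (S : Finset ℕ) :
    ∑ n ∈ S, (n : ℝ) ^ (2 * m) * ‖tail L (chebCoeff f) n‖ ^ 2 ≤
      (m : ℝ) ^ m * (rhoInt m (iteratedDeriv m f)).toReal := by
  have hm0 : (0 : ℝ) < m := by exact_mod_cast hm
  have h := sum_lam_mul_sq_le hm hf hfin (S.filter (L < ·))
    (fun n hn => by have := (Finset.mem_filter.1 hn).2; omega)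
  rw [ENNReal.ofReal_le_iff_le_toReal hfin] at h
  refine le_trans ?_ (mul_le_mul_of_nonneg_left h (by positivity))
  rw [Finset.mul_sum, Finset.mul_sum, Finset.sum_filter]
  refine Finset.sum_le_sum fun n _ => ?_
  unfold tail
  split_ifs with hn
  · have hl := lam_ge hm (show m ≤ n by omega)
    rw [div_le_iff₀' (by positivity)] at hl
    rw [chebCoeff, if_neg (by omega), norm_mul, norm_mul, norm_inv, Complex.norm_real,
      Real.norm_eq_abs, abs_of_pos Real.pi_pos, Complex.norm_ofNat, mul_pow]
    have hp : (2 * Real.pi⁻¹) ^ 2 ≤ 2 / Real.pi := by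
      have h1 : (2 : ℝ) / Real.pi ≤ 1 := by
        rw [div_le_one Real.pi_pos]; linarith [Real.pi_gt_three]
      have h0 : (0 : ℝ) ≤ 2 / Real.pi := by positivity
      rw [← div_eq_mul_inv]; nlinarith
    calc (n : ℝ) ^ (2 * m) * ((2 * Real.pi⁻¹) ^ 2 * ‖cosInt f n‖ ^ 2)
        ≤ (m : ℝ) ^ m * lam m n * (2 / Real.pi * ‖cosInt f n‖ ^ 2) := by
          have := lam_pos hm (show m ≤ n by omega)
          gcongr
      _ = _ := by ring
  · simp

theorem sum_tail_inv_sq_le {L : ℕ} (hL : 1 ≤ L) (S : Finset ℕ) (hS : ∀ n ∈ S, L < n) :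
    ∑ n ∈ S, ((n : ℝ) ^ 2)⁻¹ ≤ 2 / L := by
  have h1 : S ⊆ Finset.Ioo L (S.sup id + 1) := fun n hn => by
    rw [Finset.mem_Ioo]
    exact ⟨hS n hn, Nat.lt_succ_of_le (Finset.le_sup (f := id) hn)⟩
  calc _ ≤ ∑ n ∈ Finset.Ioo L (S.sup id + 1), ((n : ℝ) ^ 2)⁻¹ :=
        Finset.sum_le_sum_of_subset_of_nonneg h1 fun _ _ _ => by positivity
    _ ≤ 2 / (L + 1) := sum_Ioo_inv_sq_le (α := ℝ) L _
    _ ≤ 2 / L := by gcongr; linarith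

/-- Weighted sums of coefficients from weighted square sums. -/
theorem sum_pow_mul_norm_sq_le {a : ℕ → ℂ} {L q d : ℕ} {M : ℝ} (hL : 1 ≤ L)
    (ha : ∀ n ≤ L, a n = 0)
    (hM : ∀ S : Finset ℕ, ∑ n ∈ S, (n : ℝ) ^ (2 * (q + 1 + d)) * ‖a n‖ ^ 2 ≤ M) (S : Finset ℕ) :
    (∑ n ∈ S, (n : ℝ) ^ q * ‖a n‖) ^ 2 ≤ 2 * M / (L : ℝ) ^ (2 * d + 1) := by
  have hL0 : (0 : ℝ) < L := by exact_mod_cast hL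
  -- Split off n^{−(d+1)} for Cauchy–Schwarz; the squares of this factor sum to at most 2/L^{2d+1}
  -- over n > L.
  have e1 : ∑ n ∈ S, (n : ℝ) ^ q * ‖a n‖ = ∑ n ∈ S.filter (L < ·),
      ((n : ℝ) ^ (d + 1))⁻¹ * ((n : ℝ) ^ (q + 1 + d) * ‖a n‖) := by
    rw [Finset.sum_filter]
    refine Finset.sum_congr rfl fun n _ => ?_
    split_ifs with h
    · have : (n : ℝ) ≠ 0 := by
        have : n ≠ 0 := by omega
        exact_mod_cast this
      field_simp
      ring
    · simp [ha n (by omega)]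
  have h1 : ∑ n ∈ S.filter (L < ·), (((n : ℝ) ^ (d + 1))⁻¹) ^ 2 ≤ 2 / (L : ℝ) ^ (2 * d + 1) := by
    calc _ ≤ ∑ n ∈ S.filter (L < ·), ((L : ℝ) ^ (2 * d))⁻¹ * ((n : ℝ) ^ 2)⁻¹ := by
          refine Finset.sum_le_sum fun n hn => ?_
          have hn : (L : ℝ) ≤ n := by exact_mod_cast (Finset.mem_filter.1 hn).2.le
          have hn0 : (0 : ℝ) < n := by linarith
          rw [inv_pow, ← mul_inv]
          refine inv_anti₀ (by positivity) ?_
          calc (L : ℝ) ^ (2 * d) * (n : ℝ) ^ 2 ≤ (n : ℝ) ^ (2 * d) * (n : ℝ) ^ 2 := by gcongr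
            _ = _ := by ring
      _ ≤ ((L : ℝ) ^ (2 * d))⁻¹ * (2 / L) := by
          rw [← Finset.mul_sum]
          gcongr
          exact sum_tail_inv_sq_le hL _ fun n hn => (Finset.mem_filter.1 hn).2
      _ = _ := by field_simp; ring
  have h2 : ∑ n ∈ S.filter (L < ·), ((n : ℝ) ^ (q + 1 + d) * ‖a n‖) ^ 2 ≤ M := by
    refine le_trans (le_of_eq (Finset.sum_congr rfl fun n _ => ?_)) (hM (S.filter (L < ·)))
    ring
  rw [e1]
  calc _ ≤ _ := Finset.sum_mul_sq_le_sq_mul_sq _ _ _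
    _ ≤ 2 / (L : ℝ) ^ (2 * d + 1) * M := by
        gcongr
    _ = _ := by ring

theorem summable_pow_mul_norm {a : ℕ → ℂ} {L q d : ℕ} {M : ℝ} (hL : 1 ≤ L)
    (ha : ∀ n ≤ L, a n = 0)
    (hM : ∀ S : Finset ℕ, ∑ n ∈ S, (n : ℝ) ^ (2 * (q + 1 + d)) * ‖a n‖ ^ 2 ≤ M) :
    Summable (fun n : ℕ => (n : ℝ) ^ q * ‖a n‖) ∧
      ∑' n : ℕ, (n : ℝ) ^ q * ‖a n‖ ≤ √(2 * M / (L : ℝ) ^ (2 * d + 1)) := by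
  have h : ∀ S : Finset ℕ, ∑ n ∈ S, (n : ℝ) ^ q * ‖a n‖ ≤ √(2 * M / (L : ℝ) ^ (2 * d + 1)) :=
    fun S => Real.le_sqrt_of_sq_le (sum_pow_mul_norm_sq_le hL ha hM S)
  have h0 : ∀ n : ℕ, 0 ≤ (n : ℝ) ^ q * ‖a n‖ := fun n => by positivity
  have hs := summable_of_sum_le h0 h
  exact ⟨hs, hs.tsum_le_of_sum_le h⟩

theorem summable_of_summable_tail {a : ℕ → ℂ} {L : ℕ} (h : Summable fun n => ‖tail L a n‖) :
    Summable a := by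
  refine (summable_congr_cofinite ?_).1 h.of_norm
  rw [Nat.cofinite_eq_atTop]
  filter_upwards [eventually_gt_atTop L] with n hn
  simp [tail, hn]

theorem summable_chebCoeff {f : ℝ → ℂ} {m : ℕ} (hm : 1 ≤ m) (hf : LocSobolev m f)
    (hfin : rhoInt m (iteratedDeriv m f) ≠ ∞) : Summable (chebCoeff f) := by
  obtain ⟨d, rfl⟩ : ∃ d, m = 0 + 1 + d := ⟨m - 1, by omega⟩
  -- Any cut-off with m ≤ L + 1 and L ≥ 1 would do, as finitely many terms do not affect
  -- summability.
  have h := (summable_pow_mul_norm (q := 0) (d := d) (L := 1 + d) (by omega)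
    (fun n hn => tail_of_le (chebCoeff f) hn)
    (sum_tail_chebCoeff_le hm (by omega) hf hfin)).1
  simp only [pow_zero, one_mul] at h
  exact summable_of_summable_tail h

theorem fourierCoeff_even {F : AddCircle (2 * Real.pi) → ℂ} {g : ℝ → ℂ} (hg : Continuous g)
    (hF : ∀ x : ℝ, F (x : AddCircle (2 * Real.pi)) = g (Real.cos x)) [Fact (0 < 2 * Real.pi)]
    (n : ℤ) :
    fourierCoeff F n = (Real.pi : ℂ)⁻¹ *
      ∫ θ in (0 : ℝ)..Real.pi, g (Real.cos θ) * Real.cos (n * θ) := by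
  have hpi : (Real.pi : ℂ) ≠ 0 := by exact_mod_cast Real.pi_pos.ne'
  rw [fourierCoeff_eq_intervalIntegral F n (-Real.pi),
    show -Real.pi + 2 * Real.pi = Real.pi by ring]
  set h : ℝ → ℂ := fun x => Complex.exp (-(n * x) * Complex.I) * g (Real.cos x) with hh
  have hc : Continuous h := by simp only [hh]; fun_prop
  have e1 : ∀ x : ℝ, fourier (-n) (x : AddCircle (2 * Real.pi)) • F x = h x := by
    intro x
    rw [hF, fourier_coe_apply, smul_eq_mul, hh]
    congr 2
    push_cast
    field_simp
  simp_rw [e1]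
  rw [← intervalIntegral.integral_add_adjacent_intervals (b := 0) (hc.intervalIntegrable _ _)
    (hc.intervalIntegrable _ _)]
  have e2 : ∫ x in (-Real.pi)..0, h x = ∫ x in (0 : ℝ)..Real.pi, h (-x) := by
    rw [intervalIntegral.integral_comp_neg (fun x => h x), neg_zero]
  rw [e2, ← intervalIntegral.integral_add (Continuous.intervalIntegrable (by fun_prop) _ _)
    (hc.intervalIntegrable _ _)]
  have e3 : ∀ x : ℝ, h (-x) + h x = 2 * (g (Real.cos x) * Real.cos (n * x)) := by
    intro x
    simp only [hh, Real.cos_neg]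
    push_cast
    rw [Complex.cos]
    ring_nf
  simp_rw [e3]
  rw [intervalIntegral.integral_const_mul, Complex.real_smul]
  push_cast
  field_simp

/-- The function θ ↦ f(1 + cos θ) is continuous, periodic and even with summable Fourier
coefficients, so its Fourier series converges to it; pairing n with −n yields cosines. -/
theorem hasSum_chebCoeff {f : ℝ → ℂ} (hf : ContinuousOn f (Icc 0 2))
    (hs : Summable (chebCoeff f)) (θ : ℝ) :
    HasSum (fun n : ℕ => chebCoeff f n * (Real.cos (n * θ) : ℂ)) (f (1 + Real.cos θ)) := by
  have hpi : (Real.pi : ℂ) ≠ 0 := by exact_mod_cast Real.pi_pos.ne'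
  have : Fact (0 < 2 * Real.pi) := ⟨Real.two_pi_pos⟩
  set g : ℝ → ℂ := fun x => IccExtend (zero_le_two (α := ℝ)) ((Icc 0 2).domRestrict f) (1 + x)
    with hg
  have hgc : Continuous g := by
    have := (continuousOn_iff_continuous_domRestrict.1 hf).Icc_extend' (h := zero_le_two (α := ℝ))
    simp only [hg]
    exact this.comp (by fun_prop)
  have hgf : ∀ x : ℝ, g (Real.cos x) = f (1 + Real.cos x) := fun x => by
    rw [hg]
    simp only
    rw [IccExtend_of_mem _ _ ⟨by linarith [Real.neg_one_le_cos x], by linarith [Real.cos_le_one x]⟩]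
    rfl
  have hper : Function.Periodic (fun x : ℝ => g (Real.cos x)) (2 * Real.pi) := fun x => by
    simp
  set F : C(AddCircle (2 * Real.pi), ℂ) :=
    ⟨hper.lift, continuous_quot_lift _ (hgc.comp Real.continuous_cos)⟩ with hF
  have hFx : ∀ x : ℝ, F (x : AddCircle (2 * Real.pi)) = g (Real.cos x) := fun x =>
    hper.lift_coe x
  have hcoef : ∀ n : ℤ, fourierCoeff F n = (Real.pi : ℂ)⁻¹ * cosInt f n.natAbs := by
    intro n
    rw [fourierCoeff_even hgc hFx, cosInt]
    congr 2
    ext x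
    rw [hgf]
    rcases Int.natAbs_eq n with h | h <;> rw [h] <;> simp
  have hs' : Summable fun n : ℕ => (Real.pi : ℂ)⁻¹ * cosInt f n := by
    refine (summable_congr_cofinite ?_).1 (hs.mul_left (1 / 2))
    rw [Nat.cofinite_eq_atTop]
    filter_upwards [eventually_gt_atTop 0] with n hn
    rw [chebCoeff, if_neg hn.ne']; ring
  have hsum : Summable (fourierCoeff F) := by
    refine Summable.of_nat_of_neg ?_ ?_ <;> simpa [hcoef] using hs'
  have h1 := (has_pointwise_sum_fourier_series_of_summable hsum (θ : AddCircle (2 * Real.pi)))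
  have h2 := h1.nat_add_neg
  -- The pairing counts the index 0 twice; one copy is removed.
  have h3 := h2.sub (hasSum_ite_eq (0 : ℕ) ((Real.pi : ℂ)⁻¹ * cosInt f 0))
  have hval : F (θ : AddCircle (2 * Real.pi)) + fourierCoeff F 0 • fourier 0
      (θ : AddCircle (2 * Real.pi)) - (Real.pi : ℂ)⁻¹ * cosInt f 0 = f (1 + Real.cos θ) := by
    rw [hFx, hgf]
    simp [hcoef]
  rw [hval] at h3
  refine (congrArg (fun w : ℕ → ℂ => HasSum w (f (1 + Real.cos θ))) (funext fun n => ?_)).mp h3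
  simp only [hcoef, smul_eq_mul, Int.natAbs_neg, Int.natAbs_natCast, fourier_coe_apply]
  have e : Complex.exp (2 * Real.pi * Complex.I * (n : ℤ) * θ / (2 * Real.pi : ℝ)) +
      Complex.exp (2 * Real.pi * Complex.I * (-(n : ℤ) : ℤ) * θ / (2 * Real.pi : ℝ)) =
      2 * Real.cos (n * θ) := by
    push_cast
    rw [Complex.cos]
    have r1 : 2 * (Real.pi : ℂ) * Complex.I * n * θ / (2 * Real.pi) = n * θ * Complex.I := by
      field_simp
    have r2 : 2 * (Real.pi : ℂ) * Complex.I * -n * θ / (2 * Real.pi) = -(n * θ) * Complex.I := by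
      field_simp
    rw [r1, r2]; ring
  rw [← mul_add, e, chebCoeff]
  split_ifs with hn
  · subst hn; simp; ring
  · simp; ring

/-! ### Aliasing -/

/-- The index in `{0, …, L}` whose cosine agrees with the `n`-th one at the points `lπ/L`. -/
def fold (L n : ℕ) : ℕ := if Even (n / L) then n % L else L - n % L

theorem fold_le {L : ℕ} (hL : 1 ≤ L) (n : ℕ) : fold L n ≤ L := by
  have := Nat.mod_lt n hL
  unfold fold; split_ifs <;> omega

theorem fold_of_le {L n : ℕ} (hL : 1 ≤ L) (h : n ≤ L) : fold L n = n := by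
  rcases h.lt_or_eq with h | rfl
  · simp [fold, Nat.div_eq_of_lt h, Nat.mod_eq_of_lt h]
  · simp [fold, Nat.div_self hL]

/-- On block k the parity of n / L is constant, so folding is either j ↦ j or j ↦ L − j. -/
theorem fold_injOn {L : ℕ} (k : ℕ) :
    Set.InjOn (fun j => fold L (k * L + j)) (Finset.range L : Finset ℕ) := by
  intro i hi j hj h
  simp only [Finset.coe_range, Set.mem_Iio] at hi hj
  have hd : ∀ i < L, (k * L + i) / L = k ∧ (k * L + i) % L = i := fun i hi => by
    rw [mul_comm k L, Nat.mul_add_div (by omega), Nat.div_eq_of_lt hi, Nat.mul_add_mod,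
      Nat.mod_eq_of_lt hi]
    simp
  simp only [fold, (hd i hi).1, (hd i hi).2, (hd j hj).1, (hd j hj).2] at h
  split_ifs at h <;> omega

/-- At θ = lπ/L, adding 2L to the frequency shifts the angle by a multiple of 2π, and cosine is
even. -/
theorem cos_fold {L : ℕ} (hL : 1 ≤ L) (n l : ℕ) :
    Real.cos (fold L n * (l * Real.pi / L)) = Real.cos (n * (l * Real.pi / L)) := by
  have hL0 : (L : ℝ) ≠ 0 := by positivity
  have hn : (n : ℝ) = L * (n / L : ℕ) + (n % L : ℕ) := by
    exact_mod_cast (Nat.div_add_mod n L).symm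
  have hlt := Nat.mod_lt n hL
  unfold fold
  split_ifs with h
  · obtain ⟨t, ht⟩ := h
    rw [hn, ht, ← Real.cos_add_nat_mul_two_pi _ (t * l)]
    congr 1
    push_cast
    field_simp
    ring
  · obtain ⟨t, ht⟩ := Nat.not_even_iff_odd.1 h
    rw [hn, ht, ← Real.cos_neg, ← Real.cos_add_nat_mul_two_pi _ ((t + 1) * l), Nat.cast_sub hlt.le]
    congr 1
    push_cast
    field_simp
    ring

theorem node_injOn {L : ℕ} (hL : 1 ≤ L) :
    Set.InjOn (fun l => (node L l : ℂ)) (Finset.range (L + 1) : Finset ℕ) := by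
  intro i hi j hj h
  have hL0 : (0 : ℝ) < L := by exact_mod_cast hL
  have mem : ∀ i ∈ (Finset.range (L + 1)), (i : ℝ) * Real.pi / L ∈ Icc 0 Real.pi := by
    intro i hi
    have : (i : ℝ) ≤ L := by exact_mod_cast Nat.lt_succ_iff.1 (Finset.mem_range.1 hi)
    refine ⟨by positivity, ?_⟩
    rw [div_le_iff₀ hL0, mul_comm]
    gcongr
  have h1 : Real.cos (i * Real.pi / L) = Real.cos (j * Real.pi / L) := by
    have : node L i = node L j := Complex.ofReal_injective h
    simpa [node] using this
  have h2 := Real.injOn_cos (mem i hi) (mem j hj) h1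
  have hp := Real.pi_pos.ne'
  field_simp at h2
  exact_mod_cast h2

theorem interpolant_chebyshev {L : ℕ} (hL : 1 ≤ L) (n : ℕ) (f : ℝ → ℂ)
    (hf : ∀ θ : ℝ, f (1 + Real.cos θ) = Real.cos (n * θ)) :
    interpolant L f =
      (Polynomial.Chebyshev.T ℂ (fold L n)).comp (Polynomial.X - Polynomial.C 1) := by
  symm
  refine Lagrange.eq_interpolate_of_eval_eq _ (node_injOn hL) ?_ ?_
  · refine lt_of_le_of_lt Polynomial.degree_le_natDegree ?_
    rw [Finset.card_range, Polynomial.natDegree_comp, Polynomial.natDegree_X_sub_C, mul_one,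
      Polynomial.Chebyshev.natDegree_T]
    have := fold_le hL n
    simp only [Int.natAbs_natCast]
    exact_mod_cast Nat.lt_succ_of_le this
  · intro l _
    rw [node, hf, ← cos_fold hL]
    simp [Polynomial.eval_comp, Polynomial.Chebyshev.T_complex_cos]

theorem eval_interpolant (L : ℕ) (f : ℝ → ℂ) (z : ℂ) :
    (interpolant L f).eval z = ∑ l ∈ Finset.range (L + 1), f (node L l) *
      (Lagrange.basis (Finset.range (L + 1)) (fun l => (node L l : ℂ)) l).eval z := by
  simp [interpolant, Lagrange.interpolate_apply, Polynomial.eval_finsetSum]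

/-- Interpolation is a finite linear combination of nodal values, so it acts termwise on the series.
Terms with n ≤ L are reproduced exactly and cancel, which leaves the tail. -/
theorem hasSum_interpError {L : ℕ} (hL : 1 ≤ L) {f : ℝ → ℂ} {a : ℕ → ℂ}
    (hf : ∀ θ : ℝ, HasSum (fun n : ℕ => a n * (Real.cos (n * θ) : ℂ)) (f (1 + Real.cos θ)))
    (θ : ℝ) :
    HasSum (fun n : ℕ => tail L a n * (Real.cos (n * θ) : ℂ) -
      tail L a n * (Real.cos (fold L n * θ) : ℂ)) (interpError L f (1 + Real.cos θ)) := by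
  have h1 : HasSum (fun n : ℕ => ∑ l ∈ Finset.range (L + 1),
      a n * (Real.cos (n * (l * Real.pi / L)) : ℂ) *
      (Lagrange.basis (Finset.range (L + 1)) (fun l => (node L l : ℂ)) l).eval
        ((1 + Real.cos θ : ℝ) : ℂ)) ((interpolant L f).eval ((1 + Real.cos θ : ℝ) : ℂ)) := by
    rw [eval_interpolant]
    exact hasSum_sum fun l _ => (hf _).mul_right _
  have h2 : ∀ n : ℕ, ∑ l ∈ Finset.range (L + 1),
      a n * (Real.cos (n * (l * Real.pi / L)) : ℂ) *
      (Lagrange.basis (Finset.range (L + 1)) (fun l => (node L l : ℂ)) l).eval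
        ((1 + Real.cos θ : ℝ) : ℂ) = a n * (Real.cos (fold L n * θ) : ℂ) := by
    intro n
    set p : ℝ → ℂ := fun s => (((Polynomial.Chebyshev.T ℝ n).eval (s - 1) : ℝ) : ℂ) with hp
    have hpc : ∀ θ : ℝ, p (1 + Real.cos θ) = Real.cos (n * θ) := fun θ => by
      simp [hp]
    have e1 := eval_interpolant L p ((1 + Real.cos θ : ℝ) : ℂ)
    rw [interpolant_chebyshev hL n p hpc] at e1
    simp only [node, hpc] at e1
    simp_rw [mul_assoc, ← Finset.mul_sum]
    simp only [node]
    rw [← e1]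
    simp [Polynomial.eval_comp, Polynomial.Chebyshev.T_complex_cos]
  simp_rw [h2] at h1
  have h3 := (hf θ).sub h1
  refine (congrArg (fun w : ℕ → ℂ => HasSum w (interpError L f (1 + Real.cos θ)))
    (funext fun n => ?_)).mp h3
  unfold tail
  split_ifs with h
  · rfl
  · rw [fold_of_le hL (by omega)]; simp

/-! ### Mean square estimates of the error -/

theorem enorm_sub_sq_le (x y : ℂ) : ‖x - y‖ₑ ^ 2 ≤ 2 * (‖x‖ₑ ^ 2 + ‖y‖ₑ ^ 2) := by
  have h : ‖x - y‖ ^ 2 ≤ 2 * (‖x‖ ^ 2 + ‖y‖ ^ 2) := by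
    have := norm_sub_le x y
    nlinarith [norm_nonneg (x - y), sq_nonneg (‖x‖ - ‖y‖)]
  have h1 := ENNReal.ofReal_le_ofReal h
  rwa [ENNReal.ofReal_mul two_pos.le, ENNReal.ofReal_add (by positivity) (by positivity),
    ENNReal.ofReal_pow (norm_nonneg _), ENNReal.ofReal_pow (norm_nonneg _),
    ENNReal.ofReal_pow (norm_nonneg _), ofReal_norm, ofReal_norm, ofReal_norm,
    ENNReal.ofReal_ofNat] at h1

/-- Two coefficient sequences are needed because difference quotients multiply the direct and the
folded terms by different factors. -/
theorem IsOrthoSystem.lintegral_aliased_sq_le {φ : ℕ → ℝ → ℝ} (hφ : IsOrthoSystem φ)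
    (hφ1 : ∀ n θ, |φ n θ| ≤ 1) {L : ℕ} (hL : 1 ≤ L) {α β : ℕ → ℂ}
    (hα : Summable fun n => ‖α n‖) (hβ : Summable fun n => ‖β n‖) (hβ0 : ∀ n < L, β n = 0)
    {G : ℝ → ℂ}
    (hG : ∀ θ, HasSum (fun n => α n * (φ n θ : ℂ) - β n * (φ (fold L n) θ : ℂ)) (G θ)) :
    (L : ℝ≥0∞) ^ 2 * ∫⁻ θ in Ioo (0 : ℝ) Real.pi, ‖G θ‖ₑ ^ 2 ≤
      2 * (ENNReal.ofReal Real.pi * ((L : ℝ≥0∞) ^ 2 * ∑' n, ‖α n‖ₑ ^ 2) +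
        ENNReal.ofReal (2 * Real.pi) * ∑' n : ℕ, (n : ℝ≥0∞) ^ 2 * ‖β n‖ₑ ^ 2) := by
  have hc := hφ.continuous
  have hb : ∀ (γ : ℕ → ℂ) (n k : ℕ) (θ : ℝ), ‖γ n * (φ k θ : ℂ)‖ ≤ ‖γ n‖ := by
    intro γ n k θ
    rw [norm_mul, Complex.norm_real]
    exact mul_le_of_le_one_right (norm_nonneg _) (hφ1 k θ)
  have s1 : ∀ θ, Summable fun n => α n * (φ n θ : ℂ) := fun θ =>
    Summable.of_norm_bounded hα fun n => hb α n n θ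
  have s2 : ∀ θ, Summable fun n => β n * (φ (fold L n) θ : ℂ) := fun θ =>
    Summable.of_norm_bounded hβ fun n => hb β n _ θ
  set P : ℝ → ℂ := fun θ => ∑' n, α n * (φ n θ : ℂ) with hP
  set Q : ℝ → ℂ := fun θ => ∑' n, β n * (φ (fold L n) θ : ℂ) with hQ
  have hPc : Continuous P := continuous_tsum (fun n => by fun_prop) hα fun n θ => hb α n n θ
  have hQc : Continuous Q := continuous_tsum (fun n => by fun_prop) hβ fun n θ => hb β n _ θ
  have hGPQ : ∀ θ, G θ = P θ - Q θ := fun θ =>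
    (hG θ).unique ((s1 θ).hasSum.sub (s2 θ).hasSum)
  have b1 := hφ.lintegral_hasSum_sq_le α fun θ _ => (s1 θ).hasSum
  have b2 := hφ.lintegral_hasSum_folded_sq_le hL (fold L) fold_injOn β hβ0 fun θ _ => (s2 θ).hasSum
  rw [lintegral_const_mul' _ _ (by simp)] at b2
  calc _ ≤ (L : ℝ≥0∞) ^ 2 *
        ∫⁻ θ in Ioo (0 : ℝ) Real.pi, 2 * (‖P θ‖ₑ ^ 2 + ‖Q θ‖ₑ ^ 2) := by
        gcongr with θ
        rw [hGPQ]
        exact enorm_sub_sq_le _ _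
    _ = 2 * ((L : ℝ≥0∞) ^ 2 * (∫⁻ θ in Ioo (0 : ℝ) Real.pi, ‖P θ‖ₑ ^ 2) +
          (L : ℝ≥0∞) ^ 2 * ∫⁻ θ in Ioo (0 : ℝ) Real.pi, ‖Q θ‖ₑ ^ 2) := by
        rw [lintegral_const_mul' _ _ (by simp), lintegral_add_left
          (hPc.measurable.enorm.pow_const 2)]
        ring
    _ ≤ 2 * ((L : ℝ≥0∞) ^ 2 * (ENNReal.ofReal Real.pi * ∑' n, ‖α n‖ₑ ^ 2) +
          ENNReal.ofReal (2 * Real.pi) * ∑' n : ℕ, (n : ℝ≥0∞) ^ 2 * ‖β n‖ₑ ^ 2) := by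
        gcongr
    _ = _ := by ring

theorem enorm_sq_mul_le {x y : ℂ} {c : ℕ} (h : ‖x‖ ≤ c * ‖y‖) :
    ‖x‖ₑ ^ 2 ≤ (c : ℝ≥0∞) ^ 2 * ‖y‖ₑ ^ 2 := by
  have h1 := ENNReal.ofReal_le_ofReal h
  rw [ENNReal.ofReal_mul (by positivity), ofReal_norm, ofReal_norm, ENNReal.ofReal_natCast] at h1
  rw [← mul_pow]
  gcongr

theorem norm_mul_sin_div_le (z : ℂ) (k : ℕ) {h : ℝ} (hh : 0 < h) :
    ‖z * ((Real.sin (k * h) / h : ℝ) : ℂ)‖ ≤ k * ‖z‖ := by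
  rw [norm_mul, Complex.norm_real, Real.norm_eq_abs, abs_div, abs_of_pos hh, mul_comm]
  gcongr
  rw [div_le_iff₀ hh]
  calc |Real.sin (k * h)| ≤ |(k : ℝ) * h| := Real.abs_sin_le_abs
    _ = k * h := abs_of_nonneg (by positivity)

section

variable {L : ℕ} (hL : 1 ≤ L) {f : ℝ → ℂ} {a : ℕ → ℂ} (hfc : ContinuousOn f (Icc 0 2))
  (hf : ∀ θ : ℝ, HasSum (fun n : ℕ => a n * (Real.cos (n * θ) : ℂ)) (f (1 + Real.cos θ)))
  (ha : Summable fun n : ℕ => ‖tail L a n‖)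

include hL hf ha in
-- The constant is 6π = 2(π + 2π): π from the direct part, 2π from the folded part, and 2 from
-- splitting the square.
theorem rhoInt_zero_interpError_le :
    (L : ℝ≥0∞) ^ 2 * rhoInt 0 (interpError L f) ≤
      ENNReal.ofReal (6 * Real.pi) * ∑' n : ℕ, (n : ℝ≥0∞) ^ 2 * ‖tail L a n‖ₑ ^ 2 := by
  have h := isOrthoSystem_cos.lintegral_aliased_sq_le (fun n θ => Real.abs_cos_le_one _) hL ha ha
    (fun n hn => tail_of_le a hn.le) (hasSum_interpError hL hf)
  rw [rhoInt_eq]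
  simp only [mul_zero, pow_zero, ENNReal.ofReal_one, mul_one]
  refine h.trans ?_
  have h1 : (L : ℝ≥0∞) ^ 2 * ∑' n, ‖tail L a n‖ₑ ^ 2 ≤
      ∑' n : ℕ, (n : ℝ≥0∞) ^ 2 * ‖tail L a n‖ₑ ^ 2 := by
    rw [← ENNReal.tsum_mul_left]
    refine ENNReal.tsum_le_tsum fun n => ?_
    rcases Nat.lt_or_ge L n with h | h
    · gcongr
    · simp [tail_of_le a h]
  calc _ ≤ 2 * (ENNReal.ofReal Real.pi * (∑' n : ℕ, (n : ℝ≥0∞) ^ 2 * ‖tail L a n‖ₑ ^ 2) +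
        ENNReal.ofReal (2 * Real.pi) * ∑' n : ℕ, (n : ℝ≥0∞) ^ 2 * ‖tail L a n‖ₑ ^ 2) := by gcongr
    _ = _ := by
        rw [← add_mul, ← mul_assoc, ← ENNReal.ofReal_add Real.pi_pos.le (by positivity),
          ← ENNReal.ofReal_ofNat 2, ← ENNReal.ofReal_mul two_pos.le]
        congr 2; ring

theorem tendsto_symm_quotient {E : ℝ → ℂ} {E' : ℂ} {θ : ℝ} (h : HasDerivAt E E' θ) {u : ℕ → ℝ}
    (hu : Tendsto u atTop (𝓝 0)) (hu0 : ∀ j, u j ≠ 0) :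
    Tendsto (fun j => (2 * (u j : ℂ))⁻¹ * (E (θ + u j) - E (θ - u j))) atTop (𝓝 E') := by
  have h1 := hasDerivAt_iff_tendsto_slope_zero.1 h
  have t1 : Tendsto u atTop (𝓝[≠] 0) :=
    tendsto_nhdsWithin_iff.2 ⟨hu, Eventually.of_forall hu0⟩
  have t2 : Tendsto (fun j => -u j) atTop (𝓝[≠] 0) :=
    tendsto_nhdsWithin_iff.2 ⟨by simpa using hu.neg, Eventually.of_forall fun j => by
      simpa using hu0 j⟩
  have h2 := ((h1.comp t1).add (h1.comp t2)).const_mul (2⁻¹ : ℂ)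
  rw [← two_mul, inv_mul_cancel_left₀ two_ne_zero] at h2
  refine h2.congr fun j => ?_
  have : (u j : ℂ) ≠ 0 := by exact_mod_cast hu0 j
  simp only [Function.comp, Complex.real_smul, ← sub_eq_add_neg]
  push_cast
  field_simp
  ring

include hL hfc hf ha in
-- For m = 1 termwise differentiation is not justified. Symmetric difference quotients of the cosine
-- series are sine series with factors sin(nh)/h and sin(n'h)/h, bounded by n and by n' ≤ L for
-- every h, and Fatou's lemma handles h → 0.
theorem rhoInt_one_deriv_interpError_le :
    rhoInt 1 (deriv (interpError L f)) ≤
      ENNReal.ofReal (6 * Real.pi) * ∑' n : ℕ, (n : ℝ≥0∞) ^ 2 * ‖tail L a n‖ₑ ^ 2 := by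
  set A := ∑' n : ℕ, (n : ℝ≥0∞) ^ 2 * ‖tail L a n‖ₑ ^ 2 with hA
  have hL0 : (L : ℝ≥0∞) ^ 2 ≠ 0 := by simp; omega
  set E : ℝ → ℂ := fun θ => interpError L f (1 + Real.cos θ) with hE
  have hEc : Continuous E := by
    have h1 : Continuous fun θ : ℝ => f (1 + Real.cos θ) :=
      hfc.comp_continuous (by fun_prop) fun θ =>
        ⟨by linarith [Real.neg_one_le_cos θ], by linarith [Real.cos_le_one θ]⟩
    simp only [hE, interpError]
    exact h1.sub ((Polynomial.continuous _).comp (by fun_prop))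
  set u : ℕ → ℝ := fun j => 1 / ((j : ℝ) + 1) with hu
  have hu0 : ∀ j, 0 < u j := fun j => by simp only [hu]; positivity
  have hut : Tendsto u atTop (𝓝 0) := tendsto_one_div_add_atTop_nhds_zero_nat
  have e1 : rhoInt 1 (deriv (interpError L f)) = ∫⁻ θ in Ioo 0 Real.pi,
      ‖deriv (interpError L f) (1 + Real.cos θ) * (-Real.sin θ : ℝ)‖ₑ ^ 2 := by
    rw [rhoInt_eq]
    refine lintegral_congr fun θ => ?_
    rw [enorm_mul, mul_pow]
    congr 1
    rw [← ofReal_norm, ← ENNReal.ofReal_pow (norm_nonneg _), Complex.norm_real, Real.norm_eq_abs,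
      sq_abs, mul_one, neg_sq]
  rw [e1]
  refine lintegral_enorm_sq_le_of_tendsto measurableSet_Ioo
    (g := fun j θ => (2 * (u j : ℂ))⁻¹ * (E (θ + u j) - E (θ - u j)))
    (fun j => Continuous.measurable (by fun_prop)) (fun θ hθ h0 => ?_) (fun j => ?_)
  · refine tendsto_symm_quotient ?_ hut fun j => (hu0 j).ne'
    have hd : DifferentiableAt ℝ (interpError L f) (1 + Real.cos θ) := by
      by_contra h
      exact h0 (by rw [deriv_zero_of_not_differentiableAt h, zero_mul])
    have := hd.hasDerivAt.scomp θ ((Real.hasDerivAt_cos θ).const_add 1)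
    rw [Complex.real_smul, mul_comm] at this
    exact this
  · set h := u j with hh
    have hp : 0 < h := hu0 j
    have hsum : ∀ θ, HasSum (fun n : ℕ =>
        -(tail L a n) * ((Real.sin (n * h) / h : ℝ) : ℂ) * (Real.sin (n * θ) : ℂ) -
        -(tail L a n) * ((Real.sin (fold L n * h) / h : ℝ) : ℂ) * (Real.sin (fold L n * θ) : ℂ))
        ((2 * (h : ℂ))⁻¹ * (E (θ + h) - E (θ - h))) := by
      intro θ
      have h1 := ((hasSum_interpError hL hf (θ + h)).sub
        (hasSum_interpError hL hf (θ - h))).mul_left (2 * (h : ℂ))⁻¹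
      refine (congrArg (fun w : ℕ → ℂ => HasSum w _) (funext fun n => ?_)).mp h1
      have key : ∀ k : ℕ, (Real.cos (k * (θ + h)) : ℂ) - Real.cos (k * (θ - h)) =
          -2 * Real.sin (k * h) * Real.sin (k * θ) := by
        intro k
        rw [mul_add, mul_sub, Real.cos_add, Real.cos_sub]
        push_cast; ring
      have hh0 : (h : ℂ) ≠ 0 := by exact_mod_cast hp.ne'
      have k1 := key n
      have k2 := key (fold L n)
      calc _ = (2 * (h : ℂ))⁻¹ * (tail L a n *
            ((Real.cos (n * (θ + h)) : ℂ) - Real.cos (n * (θ - h))) - tail L a n *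
            ((Real.cos (fold L n * (θ + h)) : ℂ) - Real.cos (fold L n * (θ - h)))) := by ring
        _ = _ := by
          rw [k1, k2]
          push_cast
          field_simp
    have nb : ∀ n : ℕ, ‖-(tail L a n) * ((Real.sin (fold L n * h) / h : ℝ) : ℂ)‖ ≤
        L * ‖tail L a n‖ := fun n => by
      refine (norm_mul_sin_div_le _ _ hp).trans ?_
      rw [norm_neg]
      gcongr
      exact fold_le hL n
    have na : ∀ n : ℕ, ‖-(tail L a n) * ((Real.sin (n * h) / h : ℝ) : ℂ)‖ ≤
        n * ‖tail L a n‖ := fun n => by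
      refine (norm_mul_sin_div_le _ _ hp).trans ?_
      rw [norm_neg]
    -- This bound depends on h and serves only summability; the estimate itself rests on `na`.
    have na' : ∀ n : ℕ, ‖-(tail L a n) * ((Real.sin (n * h) / h : ℝ) : ℂ)‖ ≤
        ‖tail L a n‖ * (1 / h) := fun n => by
      rw [norm_mul, norm_neg, Complex.norm_real, Real.norm_eq_abs, abs_div, abs_of_pos hp]
      gcongr
      exact Real.abs_sin_le_one _
    have hb := isOrthoSystem_sin.lintegral_aliased_sq_le (fun n θ => Real.abs_sin_le_one _) hL
      (Summable.of_nonneg_of_le (fun _ => norm_nonneg _) na' (ha.mul_right _))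
      (Summable.of_nonneg_of_le (fun _ => norm_nonneg _) nb (ha.mul_left _))
      (fun n hn => by rw [tail_of_le a hn.le]; simp) hsum
    have c1 : ∑' n : ℕ, ‖-(tail L a n) * ((Real.sin (n * h) / h : ℝ) : ℂ)‖ₑ ^ 2 ≤ A :=
      ENNReal.tsum_le_tsum fun n => enorm_sq_mul_le (na n)
    have c2 : ∑' n : ℕ, (n : ℝ≥0∞) ^ 2 *
        ‖-(tail L a n) * ((Real.sin (fold L n * h) / h : ℝ) : ℂ)‖ₑ ^ 2 ≤ (L : ℝ≥0∞) ^ 2 * A := by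
      rw [hA, ← ENNReal.tsum_mul_left]
      refine ENNReal.tsum_le_tsum fun n => ?_
      rw [mul_left_comm]
      gcongr
      exact enorm_sq_mul_le (nb n)
    -- The factor L² from the folded frequencies matches the one on the left and is cancelled.
    refine (ENNReal.mul_le_mul_iff_right hL0 (by simp)).1 (hb.trans ?_)
    calc _ ≤ 2 * (ENNReal.ofReal Real.pi * ((L : ℝ≥0∞) ^ 2 * A) +
          ENNReal.ofReal (2 * Real.pi) * ((L : ℝ≥0∞) ^ 2 * A)) := by gcongr
      _ = _ := by
        rw [← add_mul, ← mul_assoc, ← ENNReal.ofReal_add Real.pi_pos.le (by positivity),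
          ← ENNReal.ofReal_ofNat 2, ← ENNReal.ofReal_mul two_pos.le,
          show 2 * (Real.pi + 2 * Real.pi) = 6 * Real.pi by ring]
        ring

end

theorem summable_norm_tail {a : ℕ → ℂ} (L : ℕ) (ha : Summable a) :
    Summable fun n => ‖tail L a n‖ := by
  refine Summable.of_nonneg_of_le (fun _ => norm_nonneg _) (fun n => ?_) ha.norm
  unfold tail
  split_ifs <;> simp

theorem tsum_tail_chebCoeff_le {f : ℝ → ℂ} {m L : ℕ} (hm : 1 ≤ m) (hmL : m ≤ L + 1)
    (hf : LocSobolev m f) (hfin : rhoInt m (iteratedDeriv m f) ≠ ∞) :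
    (L : ℝ≥0∞) ^ (2 * (m - 1)) *
        ∑' n : ℕ, (n : ℝ≥0∞) ^ 2 * ‖tail L (chebCoeff f) n‖ₑ ^ 2 ≤
      ENNReal.ofReal ((m : ℝ) ^ m) * rhoInt m (iteratedDeriv m f) := by
  have h1 : ∑' n : ℕ, (n : ℝ≥0∞) ^ (2 * m) * ‖tail L (chebCoeff f) n‖ₑ ^ 2 ≤
      ENNReal.ofReal ((m : ℝ) ^ m) * rhoInt m (iteratedDeriv m f) := by
    rw [ENNReal.tsum_eq_iSup_sum]
    refine iSup_le fun S => ?_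
    have h := ENNReal.ofReal_le_ofReal (sum_tail_chebCoeff_le hm hmL hf hfin S)
    rw [ENNReal.ofReal_mul (by positivity), ENNReal.ofReal_toReal hfin,
      ENNReal.ofReal_sum_of_nonneg (fun _ _ => by positivity)] at h
    refine le_trans (le_of_eq (Finset.sum_congr rfl fun n _ => ?_)) h
    rw [ENNReal.ofReal_mul (by positivity), ENNReal.ofReal_pow (by positivity),
      ENNReal.ofReal_pow (norm_nonneg _), ofReal_norm, ENNReal.ofReal_natCast]
  refine le_trans ?_ h1
  rw [← ENNReal.tsum_mul_left]
  refine ENNReal.tsum_le_tsum fun n => ?_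
  rcases Nat.lt_or_ge L n with h | h
  · rw [← mul_assoc]
    gcongr
    calc (L : ℝ≥0∞) ^ (2 * (m - 1)) * (n : ℝ≥0∞) ^ 2 ≤
          (n : ℝ≥0∞) ^ (2 * (m - 1)) * (n : ℝ≥0∞) ^ 2 := by gcongr
      _ = _ := by rw [← pow_add]; congr 1; omega
  · simp [tail_of_le _ h]

theorem rhoNorm_eq (m : ℕ) (g : ℝ → ℂ) : rhoNorm m g = rhoInt m g ^ (1 / 2 : ℝ) := rfl

theorem rhoInt_ne_top {m : ℕ} {g : ℝ → ℂ} (h : rhoNorm m g ≠ ∞) : rhoInt m g ≠ ∞ := by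
  intro h'
  rw [rhoNorm_eq, h', ENNReal.top_rpow_of_pos (by norm_num)] at h
  exact h rfl

/-- Square roots in an estimate with a power of `L`. -/
theorem rpow_half_le {L k : ℕ} (hL : 1 ≤ L) {x y : ℝ≥0∞} {c : ℝ} (hc : 0 ≤ c)
    (h : (L : ℝ≥0∞) ^ (2 * k) * x ≤ ENNReal.ofReal c * y) :
    x ^ (1 / 2 : ℝ) ≤ ENNReal.ofReal √c * (L : ℝ≥0∞) ^ (-(k : ℝ)) * y ^ (1 / 2 : ℝ) := by
  have hL0 : (L : ℝ≥0∞) ≠ 0 := by simp; omega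
  have hLt : (L : ℝ≥0∞) ≠ ∞ := by simp
  have h1 := ENNReal.rpow_le_rpow h (show (0 : ℝ) ≤ 1 / 2 by norm_num)
  rw [ENNReal.mul_rpow_of_nonneg _ _ (by norm_num), ENNReal.mul_rpow_of_nonneg _ _ (by norm_num),
    ← ENNReal.rpow_natCast, ← ENNReal.rpow_mul, ENNReal.ofReal_rpow_of_nonneg hc (by norm_num),
    ← Real.sqrt_eq_rpow, show ((2 * k : ℕ) : ℝ) * (1 / 2) = k by push_cast; ring] at h1
  calc x ^ (1 / 2 : ℝ) = (L : ℝ≥0∞) ^ (-(k : ℝ)) * ((L : ℝ≥0∞) ^ (k : ℝ) * x ^ (1 / 2 : ℝ)) := by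
        rw [← mul_assoc, ← ENNReal.rpow_add _ _ hL0 hLt]; simp
    _ ≤ (L : ℝ≥0∞) ^ (-(k : ℝ)) * (ENNReal.ofReal √c * y ^ (1 / 2 : ℝ)) := by gcongr
    _ = _ := by ring

theorem rhoNorm_interpError_le {m L : ℕ} (hm : 1 ≤ m) (hL : 1 ≤ L) (hmL : m ≤ L + 1) {f : ℝ → ℂ}
    (hf : LocSobolev m f) (hfin : rhoNorm m (iteratedDeriv m f) ≠ ∞) :
    rhoNorm 0 (interpError L f) + (L : ℝ≥0∞)⁻¹ * rhoNorm 1 (deriv (interpError L f)) ≤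
      ENNReal.ofReal (2 * √(6 * Real.pi * (m : ℝ) ^ m)) * (L : ℝ≥0∞) ^ (-(m : ℝ)) *
        rhoNorm m (iteratedDeriv m f) := by
  have hfin' := rhoInt_ne_top hfin
  have hL0 : (L : ℝ≥0∞) ≠ 0 := by simp; omega
  have hLt : (L : ℝ≥0∞) ≠ ∞ := by simp
  have hs := hasSum_chebCoeff hf.continuousOn (summable_chebCoeff hm hf hfin')
  have hM := tsum_tail_chebCoeff_le hm hmL hf hfin'
  set A := ∑' n : ℕ, (n : ℝ≥0∞) ^ 2 * ‖tail L (chebCoeff f) n‖ₑ ^ 2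
  have ha : Summable fun n : ℕ => ‖tail L (chebCoeff f) n‖ :=
    summable_norm_tail L (summable_chebCoeff hm hf hfin')
  have h0 := rhoInt_zero_interpError_le hL hs ha
  have h1 := rhoInt_one_deriv_interpError_le hL hf.continuousOn hs ha
  have hpi : 0 ≤ 6 * Real.pi := by positivity
  have g0 : (L : ℝ≥0∞) ^ (2 * m) * rhoInt 0 (interpError L f) ≤
      ENNReal.ofReal (6 * Real.pi * (m : ℝ) ^ m) * rhoInt m (iteratedDeriv m f) := by
    calc _ = (L : ℝ≥0∞) ^ (2 * (m - 1)) * ((L : ℝ≥0∞) ^ 2 * rhoInt 0 (interpError L f)) := by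
          rw [← mul_assoc, ← pow_add]; congr 2; omega
      _ ≤ (L : ℝ≥0∞) ^ (2 * (m - 1)) * (ENNReal.ofReal (6 * Real.pi) * A) := by gcongr
      _ = ENNReal.ofReal (6 * Real.pi) * ((L : ℝ≥0∞) ^ (2 * (m - 1)) * A) := by ring
      _ ≤ ENNReal.ofReal (6 * Real.pi) *
          (ENNReal.ofReal ((m : ℝ) ^ m) * rhoInt m (iteratedDeriv m f)) := by gcongr
      _ = _ := by rw [ENNReal.ofReal_mul hpi, mul_assoc]
  have g1 : (L : ℝ≥0∞) ^ (2 * (m - 1)) * rhoInt 1 (deriv (interpError L f)) ≤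
      ENNReal.ofReal (6 * Real.pi * (m : ℝ) ^ m) * rhoInt m (iteratedDeriv m f) := by
    calc _ ≤ (L : ℝ≥0∞) ^ (2 * (m - 1)) * (ENNReal.ofReal (6 * Real.pi) * A) := by gcongr
      _ = ENNReal.ofReal (6 * Real.pi) * ((L : ℝ≥0∞) ^ (2 * (m - 1)) * A) := by ring
      _ ≤ ENNReal.ofReal (6 * Real.pi) *
          (ENNReal.ofReal ((m : ℝ) ^ m) * rhoInt m (iteratedDeriv m f)) := by gcongr
      _ = _ := by rw [ENNReal.ofReal_mul hpi, mul_assoc]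
  have r0 := rpow_half_le hL (by positivity) g0
  have r1 := rpow_half_le hL (by positivity) g1
  rw [← rhoNorm_eq, ← rhoNorm_eq] at r0 r1
  have e : (L : ℝ≥0∞)⁻¹ * (L : ℝ≥0∞) ^ (-((m - 1 : ℕ) : ℝ)) = (L : ℝ≥0∞) ^ (-(m : ℝ)) := by
    rw [← ENNReal.rpow_neg_one, ← ENNReal.rpow_add _ _ hL0 hLt, Nat.cast_sub hm]
    congr 1; push_cast; ring
  calc _ ≤ _ := add_le_add r0 (mul_le_mul_right r1 (L : ℝ≥0∞)⁻¹)
    _ = _ := by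
      rw [ENNReal.ofReal_mul two_pos.le, ENNReal.ofReal_ofNat, ← e]; ring

/-! ### Uniform estimates of the error -/

open Polynomial in
-- Induction in steps of two, through U_{k+2} = 2T_{k+2} + U_k.
theorem abs_eval_U_cos_le (k : ℕ) (θ : ℝ) :
    |(Chebyshev.U ℝ k).eval (Real.cos θ)| ≤ k + 1 := by
  induction k using Nat.twoStepInduction with
  | zero => simp
  | one =>
    simp only [Nat.cast_one, Chebyshev.U_one, eval_mul, eval_ofNat, eval_X, abs_mul]
    have := Real.abs_cos_le_one θ
    norm_num
    linarith
  | more k ih _ =>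
    have h := congrArg (eval (Real.cos θ)) (Chebyshev.U_eq_two_mul_T_add_U ℝ k)
    simp only [eval_add, eval_mul, eval_ofNat, Chebyshev.T_real_cos] at h
    push_cast
    rw [h]
    refine (abs_add_le _ _).trans ?_
    rw [abs_mul, abs_two]
    have := Real.abs_cos_le_one (((k : ℤ) + 2 : ℤ) * θ)
    linarith

open Polynomial in
theorem chebD_one (n : ℕ) (θ : ℝ) :
    chebD (n + 1) 1 θ = (n + 1) * (Chebyshev.U ℝ n).eval (Real.cos θ) := by
  simp [chebD, Chebyshev.T_derivative_eq_U]

open Polynomial in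
theorem chebD_two (n : ℕ) (θ : ℝ) :
    chebD (n + 1) 2 θ = (n + 1) * (derivative (Chebyshev.U ℝ n)).eval (Real.cos θ) := by
  have e : derivative (Chebyshev.T ℝ ((n + 1 : ℕ) : ℤ)) = C ((n : ℝ) + 1) * Chebyshev.U ℝ n := by
    rw [Chebyshev.T_derivative_eq_U]; simp
  simp only [chebD, Function.iterate_succ, Function.iterate_zero, Function.comp, id]
  rw [e, derivative_C_mul, eval_C_mul]

open Polynomial in
-- Differentiate the same recurrence: sin θ · T'_{k+2}(cos θ) = (k + 2) sin((k + 2)θ), so each step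
-- adds at most 2(k + 2).
theorem abs_sin_mul_eval_derivative_U_le (k : ℕ) (θ : ℝ) :
    |Real.sin θ * (derivative (Chebyshev.U ℝ k)).eval (Real.cos θ)| ≤ k * (k + 1) := by
  induction k using Nat.twoStepInduction with
  | zero => simp
  | one =>
    have := Real.abs_sin_le_one θ
    simp [abs_mul]
    linarith
  | more k ih _ =>
    have h := congrArg (fun p => eval (Real.cos θ) (derivative p))
      (Chebyshev.U_eq_two_mul_T_add_U ℝ k)
    have hU := Chebyshev.U_real_cos θ ((k : ℤ) + 1)
    simp only [derivative_add, derivative_mul, derivative_ofNat, zero_mul, zero_add, eval_add,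
      eval_mul, eval_ofNat, Chebyshev.T_derivative_eq_U, eval_intCast,
      show (k : ℤ) + 2 - 1 = k + 1 by ring] at h
    have e : Real.sin θ * (derivative (Chebyshev.U ℝ ((k + 2 : ℕ) : ℤ))).eval (Real.cos θ) =
        2 * (k + 2) * Real.sin ((k + 2) * θ) +
        Real.sin θ * (derivative (Chebyshev.U ℝ k)).eval (Real.cos θ) := by
      push_cast at h hU ⊢
      rw [h, show (k : ℝ) + 2 = k + 1 + 1 by ring, ← hU]
      ring
    rw [e]
    refine (abs_add_le _ _).trans ?_
    rw [abs_mul, abs_of_nonneg (by positivity : (0 : ℝ) ≤ 2 * (k + 2))]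
    have h1 := Real.abs_sin_le_one ((k + 2) * θ)
    have hk : (0 : ℝ) ≤ k := by positivity
    push_cast
    nlinarith

theorem abs_chebD_one_le (n : ℕ) (θ : ℝ) : |chebD n 1 θ| ≤ (n : ℝ) ^ 2 := by
  rcases n with _ | n
  · simp [chebD]
  · rw [chebD_one, abs_mul, abs_of_nonneg (by positivity)]
    have := abs_eval_U_cos_le n θ
    push_cast
    nlinarith

theorem abs_sin_mul_chebD_two_le (n : ℕ) (θ : ℝ) :
    |Real.sin θ * chebD n 2 θ| ≤ (n : ℝ) ^ 3 := by
  rcases n with _ | n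
  · simp [chebD]
  · rw [chebD_two, mul_left_comm, abs_mul, abs_of_nonneg (by positivity)]
    have := abs_sin_mul_eval_derivative_U_le n θ
    have hn : (0 : ℝ) ≤ n := by positivity
    push_cast
    calc ((n : ℝ) + 1) * _ ≤ (n + 1) * (n * (n + 1)) := by gcongr
      _ ≤ _ := by nlinarith [sq_nonneg ((n : ℝ) + 1)]

/-! ### Termwise differentiation of the error series -/

/-- The value `T_n^{(k)}(s - 1)`. -/
def chebS (n k : ℕ) (s : ℝ) : ℝ :=
  (Polynomial.derivative^[k] (Polynomial.Chebyshev.T ℝ n)).eval (s - 1)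

theorem hasDerivAt_chebS (n k : ℕ) (s : ℝ) : HasDerivAt (chebS n k) (chebS n (k + 1) s) s := by
  have := (Polynomial.hasDerivAt (Polynomial.derivative^[k] (Polynomial.Chebyshev.T ℝ n))
    (s - 1)).comp s ((hasDerivAt_id s).sub_const 1)
  rw [← Function.iterate_succ_apply' (f := Polynomial.derivative), mul_one] at this
  exact this

theorem exists_eq_one_add_cos {s : ℝ} (hs : s ∈ Ioo (0 : ℝ) 2) :
    ∃ θ ∈ Ioo 0 Real.pi, s = 1 + Real.cos θ := by
  rw [← image_one_add_cos] at hs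
  obtain ⟨θ, hθ, h⟩ := hs
  exact ⟨θ, hθ, by simpa using h.symm⟩

theorem chebS_one_add_cos (n k : ℕ) (θ : ℝ) : chebS n k (1 + Real.cos θ) = chebD n k θ := by
  simp [chebS, chebD]

theorem rho_one_one_add_cos {θ : ℝ} (hθ : θ ∈ Ioo 0 Real.pi) :
    rho 1 (1 + Real.cos θ) = Real.sin θ := by
  have h := sin_mul_rho hθ 1
  have hs := (Real.sin_pos_of_mem_Ioo hθ).ne'
  rw [mul_one, sq] at h
  exact mul_left_cancel₀ hs h

theorem abs_chebS_one_le (n : ℕ) {s : ℝ} (hs : s ∈ Ioo (0 : ℝ) 2) :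
    |chebS n 1 s| ≤ (n : ℝ) ^ 2 := by
  obtain ⟨θ, _, rfl⟩ := exists_eq_one_add_cos hs
  rw [chebS_one_add_cos]
  exact abs_chebD_one_le n θ

theorem rho_one_pos {s : ℝ} (hs : s ∈ Ioo (0 : ℝ) 2) : 0 < rho 1 s := by
  obtain ⟨θ, hθ, rfl⟩ := exists_eq_one_add_cos hs
  rw [rho_one_one_add_cos hθ]
  exact Real.sin_pos_of_mem_Ioo hθ

theorem rho_one_mul_abs_chebS_two_le (n : ℕ) {s : ℝ} (hs : s ∈ Ioo (0 : ℝ) 2) :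
    rho 1 s * |chebS n 2 s| ≤ (n : ℝ) ^ 3 := by
  obtain ⟨θ, hθ, rfl⟩ := exists_eq_one_add_cos hs
  rw [chebS_one_add_cos, rho_one_one_add_cos hθ]
  have := abs_sin_mul_chebD_two_le n θ
  rwa [abs_mul, abs_of_pos (Real.sin_pos_of_mem_Ioo hθ)] at this

theorem rho_one_ge {δ s : ℝ} (hδ : 0 < δ) (hs : s ∈ Ioo δ (2 - δ)) : rho 1 δ ≤ rho 1 s := by
  have h1 : δ * (2 - δ) ≤ s * (2 - s) := by nlinarith [hs.1, hs.2]
  have h0 : δ < 2 - δ := hs.1.trans hs.2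
  have h2 : 0 ≤ δ * (2 - δ) := by nlinarith
  unfold rho
  gcongr

/-- The `n`-th term of the series of the `k`-th derivative of the interpolation error. -/
def errTerm (L : ℕ) (a : ℕ → ℂ) (k n : ℕ) (s : ℝ) : ℂ :=
  tail L a n * ((chebS n k s - chebS (fold L n) k s : ℝ) : ℂ)

theorem hasDerivAt_errTerm (L : ℕ) (a : ℕ → ℂ) (k n : ℕ) (s : ℝ) :
    HasDerivAt (errTerm L a k n) (errTerm L a (k + 1) n s) s :=
  (((hasDerivAt_chebS n k s).sub (hasDerivAt_chebS (fold L n) k s)).ofReal_comp).const_mul _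

/-- Since `fold L n` ≤ L < n on the tail, the folded term obeys the same bound as the direct one.
The weight `w` will be 1 for k = 1 and `rho 1` for k = 2. -/
theorem norm_errTerm_le {L : ℕ} (hL : 1 ≤ L) (a : ℕ → ℂ) {k q n : ℕ} {s w : ℝ} (hw : 0 ≤ w)
    (h : ∀ n, w * |chebS n k s| ≤ (n : ℝ) ^ q) :
    w * ‖errTerm L a k n s‖ ≤ 2 * ((n : ℝ) ^ q * ‖tail L a n‖) := by
  rcases Nat.lt_or_ge L n with hn | hn
  · have h1 : w * |chebS (fold L n) k s| ≤ (n : ℝ) ^ q := (h _).trans (by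
      have := (fold_le hL n).trans hn.le
      gcongr)
    have h2 : w * |chebS n k s - chebS (fold L n) k s| ≤ 2 * (n : ℝ) ^ q := by
      calc _ ≤ w * (|chebS n k s| + |chebS (fold L n) k s|) := by
            gcongr; exact abs_sub _ _
        _ ≤ _ := by rw [mul_add]; linarith [h n]
    rw [errTerm, norm_mul, Complex.norm_real, Real.norm_eq_abs]
    calc _ = ‖tail L a n‖ * (w * |chebS n k s - chebS (fold L n) k s|) := by ring
      _ ≤ ‖tail L a n‖ * (2 * (n : ℝ) ^ q) := by gcongr
      _ = _ := by ring
  · simp [errTerm, tail_of_le a hn]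

section

variable {L : ℕ} (hL : 1 ≤ L) {f : ℝ → ℂ} {a : ℕ → ℂ}
  (hf : ∀ θ : ℝ, HasSum (fun n : ℕ => a n * (Real.cos (n * θ) : ℂ)) (f (1 + Real.cos θ)))

include hL hf in
theorem hasSum_errTerm {s : ℝ} (hs : s ∈ Ioo (0 : ℝ) 2) :
    HasSum (fun n => errTerm L a 0 n s) (interpError L f s) := by
  obtain ⟨θ, _, rfl⟩ := exists_eq_one_add_cos hs
  refine (congrArg (fun w : ℕ → ℂ => HasSum w _) (funext fun n => ?_)).mp
    (hasSum_interpError hL hf θ)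
  rw [errTerm, chebS_one_add_cos, chebS_one_add_cos, chebD_zero, chebD_zero]
  push_cast; ring

include hL hf in
theorem hasDerivAt_interpError (ha : Summable fun n : ℕ => (n : ℝ) ^ 2 * ‖tail L a n‖) {s : ℝ}
    (hs : s ∈ Ioo (0 : ℝ) 2) :
    HasDerivAt (interpError L f) (∑' n, errTerm L a 1 n s) s := by
  have h := hasDerivAt_tsum_of_isPreconnected (ha.mul_left 2) isOpen_Ioo isPreconnected_Ioo
    (fun n y _ => hasDerivAt_errTerm L a 0 n y)
    (fun n y hy => by
      simpa using norm_errTerm_le hL a (n := n) zero_le_one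
        (fun n => by simpa using abs_chebS_one_le n hy)) hs (hasSum_errTerm hL hf hs).summable hs
  refine h.congr_of_eventuallyEq ?_
  filter_upwards [isOpen_Ioo.mem_nhds hs] with y hy
  exact (hasSum_errTerm hL hf hy).tsum_eq.symm

include hL in
theorem summable_errTerm_one (ha : Summable fun n : ℕ => (n : ℝ) ^ 2 * ‖tail L a n‖) {s : ℝ}
    (hs : s ∈ Ioo (0 : ℝ) 2) : Summable fun n => errTerm L a 1 n s :=
  Summable.of_norm_bounded (ha.mul_left 2) fun n => by
    simpa using norm_errTerm_le hL a (n := n) zero_le_one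
        (fun n => by simpa using abs_chebS_one_le n hs)

include hL hf in
theorem norm_deriv_interpError_le (ha : Summable fun n : ℕ => (n : ℝ) ^ 2 * ‖tail L a n‖) {s : ℝ}
    (hs : s ∈ Ioo (0 : ℝ) 2) :
    ‖deriv (interpError L f) s‖ ≤ 2 * ∑' n : ℕ, (n : ℝ) ^ 2 * ‖tail L a n‖ := by
  rw [(hasDerivAt_interpError hL hf ha hs).deriv, ← tsum_mul_left]
  exact tsum_of_norm_bounded (ha.mul_left 2).hasSum fun n => by
    simpa using norm_errTerm_le hL a (n := n) zero_le_one
      (fun n => by simpa using abs_chebS_one_le n hs)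

include hL hf in
-- The bound n³ on Tₙ'' carries the weight ϱ₁, which degenerates at the endpoints. Differentiation
-- therefore takes place on (δ, 2 − δ), where ϱ₁ ≥ ϱ₁(δ) > 0.
theorem iteratedDeriv_two_interpError (ha : Summable fun n : ℕ => (n : ℝ) ^ 3 * ‖tail L a n‖)
    {s : ℝ} (hs : s ∈ Ioo (0 : ℝ) 2) :
    iteratedDeriv 2 (interpError L f) s = ∑' n, errTerm L a 2 n s := by
  have ha2 : Summable fun n : ℕ => (n : ℝ) ^ 2 * ‖tail L a n‖ := by
    refine Summable.of_nonneg_of_le (fun _ => by positivity) (fun n => ?_) ha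
    rcases Nat.eq_zero_or_pos n with rfl | hn
    · simp
    · have : (1 : ℝ) ≤ n := by exact_mod_cast hn
      gcongr
      norm_num
  obtain ⟨δ, hδ0, hδ⟩ : ∃ δ > 0, s ∈ Ioo δ (2 - δ) := by
    refine ⟨min s (2 - s) / 2, ?_, ?_, ?_⟩
    · have := lt_min hs.1 (sub_pos.2 hs.2); linarith
    · have := min_le_left s (2 - s); linarith [hs.1]
    · have := min_le_right s (2 - s); linarith [hs.2]
  have hsub : Ioo δ (2 - δ) ⊆ Ioo (0 : ℝ) 2 := fun y hy => ⟨hδ0.trans hy.1, by linarith [hy.2]⟩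
  have hδ2 : δ ∈ Ioo (0 : ℝ) 2 := ⟨hδ0, hδ.1.trans hs.2⟩
  have hr := rho_one_pos hδ2
  have h := hasDerivAt_tsum_of_isPreconnected ((ha.mul_left 2).mul_left (rho 1 δ)⁻¹) isOpen_Ioo
    isPreconnected_Ioo (fun n y _ => hasDerivAt_errTerm L a 1 n y)
    (fun n y hy => by
      rw [← div_eq_inv_mul, le_div_iff₀' hr]
      refine norm_errTerm_le hL a (n := n) hr.le (fun n => ?_)
      refine le_trans ?_ (rho_one_mul_abs_chebS_two_le n (hsub hy))
      gcongr
      exact rho_one_ge hδ0 hy) hδ (summable_errTerm_one hL ha2 hs) hδ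
  rw [iteratedDeriv_succ, iteratedDeriv_one, ← h.deriv]
  refine EventuallyEq.deriv_eq ?_
  filter_upwards [isOpen_Ioo.mem_nhds hs] with y hy
  exact (hasDerivAt_interpError hL hf ha2 hy).deriv

include hL hf in
theorem norm_rho_mul_iteratedDeriv_two_le
    (ha : Summable fun n : ℕ => (n : ℝ) ^ 3 * ‖tail L a n‖) {s : ℝ} (hs : s ∈ Ioo (0 : ℝ) 2) :
    ‖(rho 1 s : ℂ) * iteratedDeriv 2 (interpError L f) s‖ ≤
      2 * ∑' n : ℕ, (n : ℝ) ^ 3 * ‖tail L a n‖ := by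
  rw [iteratedDeriv_two_interpError hL hf ha hs, ← tsum_mul_left, ← tsum_mul_left]
  refine tsum_of_norm_bounded (ha.mul_left 2).hasSum fun n => ?_
  rw [norm_mul, Complex.norm_real, Real.norm_eq_abs, abs_of_pos (rho_one_pos hs)]
  exact norm_errTerm_le hL a (n := n) (rho_one_pos hs).le
    (fun n => rho_one_mul_abs_chebS_two_le n hs)

end

theorem supNorm_le {g : ℝ → ℂ} {C : ℝ} (h : ∀ s ∈ Ioo (0 : ℝ) 2, ‖g s‖ ≤ C) :
    supNorm g ≤ ENNReal.ofReal C := by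
  rw [supNorm, eLpNorm_exponent_top]
  refine eLpNormEssSup_le_of_ae_bound ?_
  filter_upwards [ae_restrict_mem measurableSet_Ioo] with s hs
  exact h s hs

/-- The origin of 5/2: with m = 3 + d the tail decays like L^{−(d+1/2)} = L^{5/2−m} ≤ L^{m₀−m}. -/
theorem ofReal_tail_bound_le {K : ℝ} (hK : 0 ≤ K) {L d : ℕ} (hL : 1 ≤ L) {m₀ : ℝ}
    (hm₀ : 5 / 2 < m₀) {R : ℝ≥0∞} (hR : R ≠ ∞) :
    ENNReal.ofReal (2 * √(2 * (K * R.toReal) / (L : ℝ) ^ (2 * d + 1))) ≤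
      ENNReal.ofReal (2 * √(2 * K)) * (L : ℝ≥0∞) ^ (m₀ - (3 + d : ℕ)) * R ^ (1 / 2 : ℝ) := by
  have hL1 : (1 : ℝ) ≤ L := by exact_mod_cast hL
  have hL0 : (0 : ℝ) < L := by linarith
  have e1 : (L : ℝ≥0∞) ^ (m₀ - (3 + d : ℕ)) = ENNReal.ofReal ((L : ℝ) ^ (m₀ - (3 + d : ℕ))) := by
    rw [← ENNReal.ofReal_natCast, ENNReal.ofReal_rpow_of_pos hL0]
  have e2 : R ^ (1 / 2 : ℝ) = ENNReal.ofReal √R.toReal := by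
    rw [Real.sqrt_eq_rpow, ← ENNReal.ofReal_rpow_of_nonneg ENNReal.toReal_nonneg (by norm_num),
      ENNReal.ofReal_toReal hR]
  rw [e1, e2, ← ENNReal.ofReal_mul (by positivity), ← ENNReal.ofReal_mul (by positivity)]
  apply ENNReal.ofReal_le_ofReal
  have e3 : √(2 * (K * R.toReal) / (L : ℝ) ^ (2 * d + 1)) =
      √(2 * K) * √R.toReal * (L : ℝ) ^ (-((d : ℝ) + 1 / 2)) := by
    have e4 : √((L : ℝ) ^ (2 * d + 1)) = (L : ℝ) ^ ((d : ℝ) + 1 / 2) := by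
      rw [Real.sqrt_eq_rpow, ← Real.rpow_natCast, ← Real.rpow_mul hL0.le]
      congr 1; push_cast; ring
    rw [← mul_assoc, Real.sqrt_div' _ (by positivity), Real.sqrt_mul (by positivity), e4,
      Real.rpow_neg hL0.le, div_eq_mul_inv]
  have e5 : (L : ℝ) ^ (-((d : ℝ) + 1 / 2)) ≤ (L : ℝ) ^ (m₀ - (3 + d : ℕ)) := by
    refine Real.rpow_le_rpow_of_exponent_le hL1 ?_
    push_cast; linarith
  rw [e3]
  calc _ = 2 * √(2 * K) * (L : ℝ) ^ (-((d : ℝ) + 1 / 2)) * √R.toReal := by ring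
    _ ≤ _ := by gcongr

/-- `K` is left free so that both estimates of (b) can share one constant. -/
theorem supNorm_deriv_interpError_le {d L : ℕ} {m₀ : ℝ} (hm₀ : 5 / 2 < m₀) (hmL : 3 + d ≤ L + 1)
    {f : ℝ → ℂ} (hf : LocSobolev (3 + d) f)
    (hfin : rhoNorm (3 + d) (iteratedDeriv (3 + d) f) ≠ ∞) {K : ℝ}
    (hK : ((3 + d : ℕ) : ℝ) ^ (3 + d) ≤ K) :
    supNorm (deriv (interpError L f)) ≤ ENNReal.ofReal (2 * √(2 * K)) *
      (L : ℝ≥0∞) ^ (m₀ - (3 + d : ℕ)) * rhoNorm (3 + d) (iteratedDeriv (3 + d) f) := by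
  have hfin' := rhoInt_ne_top hfin
  have hK0 : 0 ≤ K := le_trans (by positivity) hK
  have hL : 1 ≤ L := by omega
  have hs := hasSum_chebCoeff hf.continuousOn (summable_chebCoeff (by omega) hf hfin')
  have hM := summable_pow_mul_norm (q := 2) (d := d) hL (fun n hn => tail_of_le (chebCoeff f) hn)
    (fun S => (sum_tail_chebCoeff_le (by omega) hmL hf hfin' S).trans
      (mul_le_mul_of_nonneg_right hK ENNReal.toReal_nonneg))
  rw [rhoNorm_eq]
  refine le_trans (supNorm_le fun s hs' => ?_) (ofReal_tail_bound_le hK0 hL hm₀ hfin')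
  refine (norm_deriv_interpError_le hL hs hM.1 hs').trans ?_
  linarith [hM.2]

theorem supNorm_rho_mul_iteratedDeriv_two_le {d L : ℕ} {m₀ : ℝ} (hm₀ : 5 / 2 < m₀)
    (hmL : 3 + d ≤ L) {f : ℝ → ℂ} (hf : LocSobolev (3 + d + 1) f)
    (hfin : rhoNorm (3 + d + 1) (iteratedDeriv (3 + d + 1) f) ≠ ∞) :
    supNorm (fun s => (rho 1 s : ℂ) * iteratedDeriv 2 (interpError L f) s) ≤
      ENNReal.ofReal (2 * √(2 * ((3 + d + 1 : ℕ) : ℝ) ^ (3 + d + 1))) *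
      (L : ℝ≥0∞) ^ (m₀ - (3 + d : ℕ)) *
        rhoNorm (3 + d + 1) (iteratedDeriv (3 + d + 1) f) := by
  have hfin' := rhoInt_ne_top hfin
  have hL : 1 ≤ L := by omega
  have hs := hasSum_chebCoeff hf.continuousOn (summable_chebCoeff (by omega) hf hfin')
  have hM := summable_pow_mul_norm (q := 3) (d := d) hL (fun n hn => tail_of_le (chebCoeff f) hn)
    (fun S => by
      rw [show 3 + 1 + d = 3 + d + 1 by ring]
      exact sum_tail_chebCoeff_le (by omega) (by omega) hf hfin' S)
  rw [rhoNorm_eq]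
  refine le_trans (supNorm_le fun s hs' => ?_)
    (ofReal_tail_bound_le (by positivity) hL hm₀ hfin')
  refine (norm_rho_mul_iteratedDeriv_two_le hL hs hM.1 hs').trans ?_
  linarith [hM.2]

/-- For the void case of an infinite norm: as 0 · ∞ = 0, the prefactor has to be nonzero. -/
theorem le_mul_rpow_mul_top {x : ℝ≥0∞} {C : ℝ≥0} (hC : 0 < C) {L : ℕ} (hL : 1 ≤ L) (t : ℝ) :
    x ≤ C * (L : ℝ≥0∞) ^ t * ∞ := by
  rw [ENNReal.mul_top]
  · exact le_top
  · refine mul_ne_zero (by exact_mod_cast hC.ne') ?_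
    have hL0 : (L : ℝ≥0∞) ≠ 0 := by simp; omega
    exact (ENNReal.rpow_pos (pos_iff_ne_zero.2 hL0) (by simp)).ne'

end ClenshawCurtis

end

theorem proposition3p3 :
    (∀ m : ℕ, 1 ≤ m → ∃ C : ℝ≥0, 0 < C ∧
      ∀ L : ℕ, 1 ≤ L → m ≤ L + 1 → ∀ f : ℝ → ℂ, ClenshawCurtis.LocSobolev m f →
        ClenshawCurtis.rhoNorm 0 (ClenshawCurtis.interpError L f) +
            (L : ℝ≥0∞)⁻¹ * ClenshawCurtis.rhoNorm 1 (deriv (ClenshawCurtis.interpError L f)) ≤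
          C * (L : ℝ≥0∞) ^ (-(m : ℝ)) * ClenshawCurtis.rhoNorm m (iteratedDeriv m f)) ∧
    (∀ (m : ℕ) (m₀ : ℝ), 5 / 2 < m₀ → m₀ ≤ m → ∃ C : ℝ≥0, 0 < C ∧
      (∀ L : ℕ, m ≤ L + 1 → ∀ f : ℝ → ℂ, ClenshawCurtis.LocSobolev m f →
        ClenshawCurtis.supNorm (deriv (ClenshawCurtis.interpError L f)) ≤
          C * (L : ℝ≥0∞) ^ (m₀ - m) * ClenshawCurtis.rhoNorm m (iteratedDeriv m f)) ∧
      (∀ L : ℕ, m ≤ L → ∀ f : ℝ → ℂ, ClenshawCurtis.LocSobolev (m + 1) f →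
        ClenshawCurtis.supNorm (fun s => (ClenshawCurtis.rho 1 s : ℂ) *
            iteratedDeriv 2 (ClenshawCurtis.interpError L f) s) ≤
          C * (L : ℝ≥0∞) ^ (m₀ - m) *
            ClenshawCurtis.rhoNorm (m + 1) (iteratedDeriv (m + 1) f))) := by
  refine ⟨fun m hm => ?_, fun m m₀ hm₀ hm => ?_⟩
  · have hm0 : (0 : ℝ) < m := by exact_mod_cast hm
    have hC : 0 < Real.toNNReal (2 * √(6 * Real.pi * (m : ℝ) ^ m)) :=
      Real.toNNReal_pos.2 (by positivity)
    refine ⟨_, hC, fun L hL hmL f hf => ?_⟩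
    by_cases hfin : ClenshawCurtis.rhoNorm m (iteratedDeriv m f) = ∞
    · rw [hfin]; exact ClenshawCurtis.le_mul_rpow_mul_top hC hL _
    · exact ClenshawCurtis.rhoNorm_interpError_le hm hL hmL hf hfin
  -- An integer m ≥ m₀ > 5/2 is at least 3.
  · obtain ⟨d, rfl⟩ : ∃ d, m = 3 + d := by
      have h2 : (2 : ℝ) < m := by linarith
      have h3 : 2 < m := by exact_mod_cast h2
      exact ⟨m - 3, by omega⟩
    -- The constant of the second estimate; it also serves the first because mᵐ ≤ (m + 1)^{m+1}.
    have hC : 0 < Real.toNNReal (2 * √(2 * ((3 + d + 1 : ℕ) : ℝ) ^ (3 + d + 1))) :=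
      Real.toNNReal_pos.2 (by positivity)
    refine ⟨_, hC, fun L hmL f hf => ?_, fun L hmL f hf => ?_⟩
    · by_cases hfin : ClenshawCurtis.rhoNorm (3 + d) (iteratedDeriv (3 + d) f) = ∞
      · rw [hfin]; exact ClenshawCurtis.le_mul_rpow_mul_top hC (by omega) _
      · refine ClenshawCurtis.supNorm_deriv_interpError_le hm₀ hmL hf hfin ?_
        exact_mod_cast (Nat.pow_le_pow_left (Nat.le_succ _) _).trans
          (Nat.pow_le_pow_right (by omega) (Nat.le_succ _))
    · by_cases hfin : ClenshawCurtis.rhoNorm (3 + d + 1) (iteratedDeriv (3 + d + 1) f) = ∞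
      · rw [hfin]; exact ClenshawCurtis.le_mul_rpow_mul_top hC (by omega) _
      · exact ClenshawCurtis.supNorm_rho_mul_iteratedDeriv_two_le hm₀ hmL hf hfin
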